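/- **Setting.** Let $\mathcal N\subset\mathcal M$ be an irreducible inclusion of von Neumann algebras (hence of factors; type III in the intended application) with inclusion map $\iota$, possessing a conjugate $\bar\iota:\mathcal M\to\mathcal N$ (finite index). For unital $*$-homomorphisms $\mu,\nu$ with target $\mathcal M$ put $\mathrm{Hom}(\nu,\mu)=\{t\in\mathcal M: t\mu(x)=\nu(x)t\ \forall x\}$, with inner product $t^*s=(t,s)1$ if $\mu$ is irreducible, and $s\times t=s\,\sigma(t)$ for $s\in\mathrm{Hom}(\lambda,\sigma)$. Let ${}_{\mathcal N}X_{\mathcal N}$ be a finite system of mutually inequivalent irreducible finite-index endomorphisms of $\mathcal N$, containing the identity up to equivalence, closed (up to equivalence) under conjugation and fusion, and containing all constituents of $\bar\iota\iota$. Let ${}_{\mathcal M}X_{\mathcal N}$ and ${}_{\mathcal M}X_{\mathcal M}$ be the (finite) systems of irreducible constituents, one representative for each class, of the $\iota\lambda$, respectively of the $\iota\lambda\bar\iota$, $\lambda\in{}_{\mathcal N}X_{\mathcal N}$. For each object $\mu$ of these systems and for $\iota$ fix a conjugate $\bar\mu$ and $r_\mu\in\mathrm{Hom}(\bar\mu\mu,\mathrm{id})$,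 $\bar r_\mu\in\mathrm{Hom}(\mu\bar\mu,\mathrm{id})$ with $(1_\mu\times r_\mu^*)(\bar r_\mu\times 1_\mu)=1_\mu$, $(1_{\bar\mu}\times\bar r_\mu^*)(r_\mu\times1_{\bar\mu})=1_{\bar\mu}$, $r_\mu^*r_\mu=\bar r_\mu^*\bar r_\mu=d_\mu 1$. Below $a,b,a',b',\dots\in{}_{\mathcal M}X_{\mathcal N}$ and $B,M_i,\dots\in{}_{\mathcal M}X_{\mathcal M}$, and orthonormal bases (ONBs) of all intertwiner spaces that occur are fixed. **Double triangle algebra.** $\lozenge=\bigoplus_{a,b,a',b'}\mathrm{Hom}(a'\bar b',a\bar b)$ with the product $$x\star y=\delta_{b',c'}\,\delta_{b,c}\,(1_{a'}\times r_{b'}^*\times 1_{\bar d'})(x\times y)(1_a\times r_b\times 1_{\bar d})$$ for $x\in\mathrm{Hom}(a'\bar b',a\bar b)$, $y\in\mathrm{Hom}(c'\bar d',c\bar d)$; its unit is $\bigoplus_{a,c}\bar r_c\bar r_a^*$, where $\bar r_c\bar r_a^*\in\mathrm{Hom}(c\bar c,a\bar a)$. It has the basis $e^{b',a',s}_{B;b,a,t}=(d_ad_bd_{a'}d_{b'})^{1/4}\,s\,t^*$,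 where $s$, $t$ run through the ONBs of $\mathrm{Hom}(a'\bar b',B)$, $\mathrm{Hom}(a\bar b,B)$. **Chain.** Let $L=2k$, $k\ge1$. A path from $a_0$ to $a_L$ of length $L$ is a sequence of objects $a_0,M_1,a_2,M_3,\dots,M_{L-1},a_L$ together with ONB elements $t_1\in\mathrm{Hom}(a_0\bar\iota,M_1)$, $t_2\in\mathrm{Hom}(M_1\iota,a_2)$, ..., $t_L\in\mathrm{Hom}(M_{L-1}\iota,a_L)$. $\mathscr V^L_{\rm open}$ is the complex vector space with basis vectors $|P\rangle$ labelled by all such paths $P$. **Symbols.** For intertwiners in the appropriate ONBs define the scalars $$U_B\begin{pmatrix}&t_1&\\ t_3&&t_2\\&t_4&\end{pmatrix}=[(t_3\times1_{\bar\iota})t_4]^*(1_B\times t_1)t_2,\qquad \overline U_B\begin{pmatrix}&t_1&\\ t_2&&t_3\\&t_4&\end{pmatrix}=[(t_2\times1_{\iota})t_4]^*(1_B\times t_1)t_3,$$ with $t_1\in\mathrm{Hom}(a_1\bar\iota,M_1)$, $t_2\in\mathrm{Hom}(BM_1,M_2)$, $t_3\in\mathrm{Hom}(Ba_1,a_2)$,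 $t_4\in\mathrm{Hom}(a_2\bar\iota,M_2)$ for $U_B$, and $t_1\in\mathrm{Hom}(M_1\iota,a_1)$, $t_2\in\mathrm{Hom}(BM_1,M_2)$, $t_3\in\mathrm{Hom}(Ba_1,a_2)$, $t_4\in\mathrm{Hom}(M_2\iota,a_2)$ for $\overline U_B$. For $t\in\mathrm{Hom}(a\bar b,B)$, $u_1\in\mathrm{Hom}(a\bar\iota,A_1)$, $u_2\in\mathrm{Hom}(BA_2,A_1)$, $u_3\in\mathrm{Hom}(b\bar\iota,A_2)$ put $$Z^B_{a,\bar b}(t;u_3,u_2,u_1)=u_2^*(t^*\times u_3^*)(1_a\times r_b\times1_{\bar\iota})u_1 .$$ For $t\in\mathrm{Hom}(M\iota,b)$ let $\tilde t=(d_b/d_M)^{-1/2}(t^*\times1_{\bar\iota})(1_M\times\bar r_\iota)\in\mathrm{Hom}(b\bar\iota,M)$ be its Frobenius dual. **MPO.** For a path $P=(t_1,\dots,t_L)$ from $b'$ to $b$ and a path $P'=(t_1',\dots,t_L')$ from $a'$ to $a$ set $$(E^{b',a',s;L}_{B;b,a,t})^P_{P'}=[d_ad_bd_{a'}d_{b'}]^{1/4}\sum_{s_1,\dots,s_{L-1}}\overline{Z^B_{a',\bar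 b'}(s;t_1,s_1,t_1')}\;\prod_{j=1}^{k-1}\left\{\overline U_B\begin{pmatrix}&t_{2j}&\\ s_{2j-1}&&s_{2j}\\&t_{2j}'&\end{pmatrix}U_B\begin{pmatrix}&t_{2j+1}&\\ s_{2j}&&s_{2j+1}\\&t_{2j+1}'&\end{pmatrix}\right\}\;Z^B_{a,\bar b}(t;\tilde t_L,s_{L-1},\tilde t_L'),$$ where the $s_i$ run through the ONBs of $\mathrm{Hom}(BM_i,M_i')$ ($i$ odd) and $\mathrm{Hom}(Ba_i,a_i')$ ($i$ even); the matrix element is $0$ if the end points of $P,P'$ are not as stated. The operator is $E|P\rangle=\sum_{P'}E^P_{P'}|P'\rangle$. **Theorem.** For every even $L\ge2$ the linear map $$\pi^L:\lozenge\to\mathrm{End}(\mathscr V^L_{\rm open}),\qquad e^{b',a',s}_{B;b,a,t}\mapsto E^{b',a',s;L}_{B;b,a,t},$$ exists, is uniquely determined by its values on these elements, and is a (unital) representation of the algebra $(\lozenge,\star)$: $\pi^L(x\star y)=\pi^L(x)\pi^L(y)$ and $\pi^L$ maps the unit of $\lozenge$ to the identity. -/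

import Mathlib

namespace DoubleTriangle

noncomputable section

/-! ### Intertwiner calculus for endomorphisms -/

section Calculus

variable {A B C : Type*}
  [Ring A] [StarRing A] [Algebra ℂ A]
  [Ring B] [StarRing B] [Algebra ℂ B]
  [Ring C] [StarRing C] [Algebra ℂ C]

/-- The space `Hom(ν, μ)` of intertwiners: all `t` in the target algebra with
`t μ(x) = ν(x) t` for all `x`. Elements go from `μ` to `ν`. -/
def Hom (ν μ : A →⋆ₐ[ℂ] B) : Submodule ℂ B where
  carrier := {t | ∀ x : A, t * μ x = ν x * t}
  add_mem' := by
    intro s t hs ht x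
    rw [add_mul, mul_add, show s * μ x = ν x * s from hs x, show t * μ x = ν x * t from ht x]
  zero_mem' := by
    intro x
    simp
  smul_mem' := by
    intro c t ht x
    rw [smul_mul_assoc, mul_smul_comm, show t * μ x = ν x * t from ht x]

/-- `μ` is irreducible (simple): its only self-intertwiners are the scalars. -/
def IsIrred (μ : A →⋆ₐ[ℂ] B) : Prop :=
  ∀ t ∈ Hom μ μ, ∃ c : ℂ, t = c • (1 : B)

/-- Unitary equivalence of endomorphisms. -/
def Equivalent (ν μ : A →⋆ₐ[ℂ] B) : Prop :=
  ∃ u ∈ Hom ν μ, star u * u = 1 ∧ u * star u = 1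

/-- `T` is an orthonormal basis of `Hom(ν, μ)` with respect to the inner product
`(s, t) 1 = s* t` (for irreducible `μ`). -/
structure IsONB (ν μ : A →⋆ₐ[ℂ] B) (T : Finset B) : Prop where
  isometry : ∀ t ∈ T, star t * t = 1
  orthogonal : ∀ s ∈ T, ∀ t ∈ T, s ≠ t → star s * t = 0
  span_eq : Submodule.span ℂ (T : Set B) = Hom ν μ

theorem IsONB.mem {ν μ : A →⋆ₐ[ℂ] B} {T : Finset B} (h : IsONB ν μ T) {t : B} (ht : t ∈ T) :
    t ∈ Hom ν μ :=
  h.span_eq ▸ Submodule.subset_span (Finset.mem_coe.mpr ht)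

/-- `ν` is a finite direct sum, with multiplicities, of members of the family `μ`:
there are orthonormal bases of the spaces `Hom(ν, μ i)` with `∑ t t* = 1`. -/
def Decomposes {I : Type*} [Fintype I] (ν : A →⋆ₐ[ℂ] B) (μ : I → (A →⋆ₐ[ℂ] B)) : Prop :=
  ∃ T : I → Finset B, (∀ i, IsONB ν (μ i) (T i)) ∧ ∑ i, ∑ t ∈ T i, t * star t = 1

/-- A conjugate of `a` together with a normalized solution of the conjugacy relations:
`r ∈ Hom(ā a, id)`, `rbar ∈ Hom(a ā, id)`, `(1_a × r*)(rbar × 1_a) = 1_a`,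
`(1_ā × rbar*)(r × 1_ā) = 1_ā` and `r* r = d 1 = rbar* rbar`. If `a` is irreducible, the number
`d` does not depend on the choices: it is the (quantum) dimension of `a`. Having a conjugate
means that `a` has finite index. -/
structure Conjugate (a : A →⋆ₐ[ℂ] B) where
  /-- the conjugate endomorphism -/
  bar : B →⋆ₐ[ℂ] A
  r : A
  rbar : B
  d : ℝ
  r_mem : r ∈ Hom (bar.comp a) (StarAlgHom.id ℂ A)
  rbar_mem : rbar ∈ Hom (a.comp bar) (StarAlgHom.id ℂ B)
  conj_left : a (star r) * rbar = 1
  conj_right : bar (star rbar) * r = 1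
  norm_r : star r * r = (d : ℂ) • (1 : A)
  norm_rbar : star rbar * rbar = (d : ℂ) • (1 : B)

open Classical in
/-- The complex number `c` if `x = c 1` (and `0` if `x` is not a multiple of the identity). -/
def scalar (x : B) : ℂ :=
  if h : ∃ c : ℂ, x = c • (1 : B) then h.choose else 0

/-- The product `s × t = s σ(t)` of `s ∈ Hom(lam, σ)` and `t ∈ Hom(μ, ν)`, an element of
`Hom(lam μ, σ ν)`. In particular `1_σ × t = σ(t)` and `s × 1_μ = s`. -/
def dhr (σ : A →⋆ₐ[ℂ] B) (s : B) (t : A) : B := s * σ t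

end Calculus

/-! ### Systems of endomorphisms -/

/-- The finite systems of endomorphisms attached to an irreducible inclusion `ι : 𝒩 → ℳ` with
finite index. Indices `NN`, `MN`, `MM` label the irreducible objects of `𝒩-𝒩`, `ℳ-𝒩` and `ℳ-ℳ`
type. The `𝒩-ℳ` objects are the conjugates of the `ℳ-𝒩` objects. -/
structure EndoSystem {𝒩 ℳ : Type*} [Ring 𝒩] [StarRing 𝒩] [Algebra ℂ 𝒩]
    [Ring ℳ] [StarRing ℳ] [Algebra ℂ ℳ] (ι : 𝒩 →⋆ₐ[ℂ] ℳ) where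
  /-- the inclusion is irreducible: the relative commutant is trivial -/
  iota_irred : IsIrred ι
  /-- the inclusion has finite index -/
  iotaConj : Conjugate ι
  NN : Type
  MN : Type
  MM : Type
  [fintypeNN : Fintype NN]
  [fintypeMN : Fintype MN]
  [fintypeMM : Fintype MM]
  nn : NN → (𝒩 →⋆ₐ[ℂ] 𝒩)
  mn : MN → (𝒩 →⋆ₐ[ℂ] ℳ)
  mm : MM → (ℳ →⋆ₐ[ℂ] ℳ)
  nn_irred : ∀ i, IsIrred (nn i)
  mn_irred : ∀ a, IsIrred (mn a)
  mm_irred : ∀ b, IsIrred (mm b)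
  nn_inequiv : ∀ i j, Equivalent (nn i) (nn j) → i = j
  mn_inequiv : ∀ a b, Equivalent (mn a) (mn b) → a = b
  mm_inequiv : ∀ b c, Equivalent (mm b) (mm c) → b = c
  nnConj : ∀ i, Conjugate (nn i)
  mnConj : ∀ a, Conjugate (mn a)
  mmConj : ∀ b, Conjugate (mm b)
  /-- the `𝒩-𝒩` system contains the identity -/
  nn_unit : ∃ i, Equivalent (nn i) (StarAlgHom.id ℂ 𝒩)
  /-- the `𝒩-𝒩` system is closed under conjugation -/
  nn_bar : ∀ i, ∃ j, Equivalent ((nnConj i).bar) (nn j)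
  /-- the `𝒩-𝒩` system is closed under fusion -/
  nn_fusion : ∀ i j, Decomposes ((nn i).comp (nn j)) nn
  /-- the canonical endomorphism decomposes in the `𝒩-𝒩` system -/
  theta : Decomposes (iotaConj.bar.comp ι) nn
  /-- the `ℳ-𝒩` objects are exactly the irreducible constituents of the `ι lam` -/
  mn_complete : ∀ i, Decomposes (ι.comp (nn i)) mn
  mn_appears : ∀ a, ∃ i, Hom (ι.comp (nn i)) (mn a) ≠ ⊥
  /-- the `ℳ-ℳ` objects are exactly the irreducible constituents of the `ι lam ῑ` -/
  mm_complete : ∀ i, Decomposes ((ι.comp (nn i)).comp iotaConj.bar) mm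
  mm_appears : ∀ b, ∃ i, Hom ((ι.comp (nn i)).comp iotaConj.bar) (mm b) ≠ ⊥

attribute [instance] EndoSystem.fintypeNN EndoSystem.fintypeMN EndoSystem.fintypeMM

variable {𝒩 ℳ : Type*} [Ring 𝒩] [StarRing 𝒩] [Algebra ℂ 𝒩]
  [Ring ℳ] [StarRing ℳ] [Algebra ℂ ℳ] {ι : 𝒩 →⋆ₐ[ℂ] ℳ}

namespace EndoSystem

variable (X : EndoSystem ι)

/-- The endomorphism `ῑ`. -/
abbrev iotaBar : ℳ →⋆ₐ[ℂ] 𝒩 := X.iotaConj.bar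

/-- The conjugate `b̄` of an `ℳ-𝒩` object. -/
abbrev mnBar (b : X.MN) : ℳ →⋆ₐ[ℂ] 𝒩 := (X.mnConj b).bar

/-- The intertwiner `r_b ∈ Hom(b̄ b, id)`. -/
abbrev r (b : X.MN) : 𝒩 := (X.mnConj b).r

/-- The dimension of an `ℳ-𝒩` object. -/
abbrev dMN (b : X.MN) : ℝ := (X.mnConj b).d

/-- The dimension of an `ℳ-ℳ` object. -/
abbrev dMM (b : X.MM) : ℝ := (X.mmConj b).d

/-- The endomorphism `a b̄` of `ℳ`. -/
abbrev abar (a b : X.MN) : ℳ →⋆ₐ[ℂ] ℳ := (X.mn a).comp (X.mnBar b)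

end EndoSystem

/-! ### The double triangle algebra -/

/-- The double triangle algebra, as a vector space the direct sum over `c, d, a, b` of the spaces
`Hom(c d̄, a b̄)`; the component of `x` in that space is `x c d a b`. -/
def DTA (X : EndoSystem ι) : Type _ :=
  (c d a b : X.MN) → Hom (X.abar c d) (X.abar a b)

namespace DTA

variable {X : EndoSystem ι}

instance : AddCommGroup (DTA X) :=
  inferInstanceAs (AddCommGroup ((c d a b : X.MN) → Hom (X.abar c d) (X.abar a b)))

instance : Module ℂ (DTA X) :=
  inferInstanceAs (Module ℂ ((c d a b : X.MN) → Hom (X.abar c d) (X.abar a b)))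

@[ext]
theorem ext {x y : DTA X} (h : ∀ c d a b, (x c d a b : ℳ) = y c d a b) : x = y := by
  funext c d a b
  exact Subtype.ext (h c d a b)

theorem vmul_mem {c d a b f g : X.MN} {x y : ℳ}
    (hx : x ∈ Hom (X.abar c f) (X.abar a g)) (hy : y ∈ Hom (X.abar f d) (X.abar g b)) :
    X.mn c (star (X.r f)) * dhr (X.abar a g) x y * X.mn a (X.r g)
      ∈ Hom (X.abar c d) (X.abar a b) := by
  intro m
  have h1 := (X.mnConj g).r_mem (X.mnBar b m)
  have h2 := congrArg star ((X.mnConj f).r_mem (star (X.mnBar d m)))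
  have h3 := hy m
  have h4 := hx ((X.mn f) (X.mnBar d m))
  simp only [StarAlgHom.comp_apply, StarAlgHom.coe_id, id_eq, star_mul, star_star, map_star]
    at h1 h2 h3 h4
  change X.mn c (star (X.r f)) * (x * X.mn a (X.mnBar g y)) * X.mn a (X.r g)
    * X.mn a (X.mnBar b m) = X.mn c (X.mnBar d m) *
      (X.mn c (star (X.r f)) * (x * X.mn a (X.mnBar g y)) * X.mn a (X.r g))
  calc X.mn c (star (X.r f)) * (x * X.mn a (X.mnBar g y)) * X.mn a (X.r g)
          * X.mn a (X.mnBar b m)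
      = X.mn c (star (X.r f)) * x * X.mn a (X.mnBar g y)
          * X.mn a (X.r g * X.mnBar b m) := by rw [map_mul]; simp only [mul_assoc]
    _ = X.mn c (star (X.r f)) * x * X.mn a (X.mnBar g (y * X.mn g (X.mnBar b m)))
          * X.mn a (X.r g) := by rw [h1]; simp only [map_mul, mul_assoc]
    _ = X.mn c (star (X.r f)) * (x * X.mn a (X.mnBar g (X.mn f (X.mnBar d m))))
          * X.mn a (X.mnBar g y) * X.mn a (X.r g) := by
        rw [h3]; simp only [map_mul, mul_assoc]
    _ = X.mn c (star (X.r f) * X.mnBar f (X.mn f (X.mnBar d m))) * x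
          * X.mn a (X.mnBar g y) * X.mn a (X.r g) := by
        rw [h4]; simp only [map_mul, mul_assoc]
    _ = _ := by rw [← h2]; simp only [map_mul, mul_assoc]

/-- The vertical product. On homogeneous elements `x ∈ Hom(c f̄, a ḡ)`, `y ∈ Hom(f d̄, g b̄)` it is
`(1_c × r_f* × 1)(x × y)(1_a × r_g × 1) ∈ Hom(c d̄, a b̄)`; homogeneous elements whose inner labels
do not match have product zero. -/
instance : Mul (DTA X) where
  mul x y := fun c d a b =>
    ∑ f : X.MN, ∑ g : X.MN,
      ⟨X.mn c (star (X.r f)) * dhr (X.abar a g) (x c f a g : ℳ) (y f d g b : ℳ) * X.mn a (X.r g),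
        vmul_mem (x c f a g).2 (y f d g b).2⟩

theorem mul_apply (x y : DTA X) (c d a b : X.MN) :
    ((x * y) c d a b : ℳ) = ∑ f : X.MN, ∑ g : X.MN,
      X.mn c (star (X.r f)) * ((x c f a g : ℳ) * X.mn a (X.mnBar g (y f d g b : ℳ)))
        * X.mn a (X.r g) := by
  change ((∑ f : X.MN, ∑ g : X.MN, (⟨_, _⟩ : Hom (X.abar c d) (X.abar a b)) :
    Hom (X.abar c d) (X.abar a b)) : ℳ) = _
  simp [dhr]

theorem add_apply (x y : DTA X) (c d a b : X.MN) :
    ((x + y) c d a b : ℳ) = (x c d a b : ℳ) + y c d a b := rfl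

theorem zero_apply (c d a b : X.MN) : ((0 : DTA X) c d a b : ℳ) = 0 := rfl

theorem smul_apply (z : ℂ) (x : DTA X) (c d a b : X.MN) :
    ((z • x) c d a b : ℳ) = z • (x c d a b : ℳ) := rfl

open Classical in
/-- The unit of the vertical product, the sum over `a, c` of
`rbar_c rbar_a* ∈ Hom(c c̄, a ā)`. -/
instance : One (DTA X) where
  one := fun c d a b =>
    ⟨if c = d ∧ a = b then (X.mnConj c).rbar * star (X.mnConj a).rbar else 0, by
      split_ifs with h
      · obtain ⟨rfl, rfl⟩ := h
        intro m
        have h1 := (X.mnConj c).rbar_mem m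
        have h2 := congrArg star ((X.mnConj a).rbar_mem (star m))
        simp only [StarAlgHom.comp_apply, StarAlgHom.coe_id, id_eq, star_mul, star_star, map_star]
          at h1 h2 ⊢
        rw [mul_assoc, ← h2, ← mul_assoc, h1, mul_assoc]
      · exact Submodule.zero_mem _⟩

open Classical in
theorem one_apply (c d a b : X.MN) : ((1 : DTA X) c d a b : ℳ) =
    if c = d ∧ a = b then (X.mnConj c).rbar * star (X.mnConj a).rbar else 0 := rfl

theorem one_mul_aux (x : DTA X) : 1 * x = x := by
  classical
  ext c d a b
  rw [mul_apply]
  have h : ∀ f g : X.MN, X.mn c (star (X.r f)) * (((1 : DTA X) c f a g : ℳ)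
      * X.mn a (X.mnBar g (x f d g b : ℳ))) * X.mn a (X.r g)
      = if c = f then (if a = g then (x f d g b : ℳ) else 0) else 0 := by
    intro f g
    rw [one_apply]
    by_cases hf : c = f
    · by_cases hg : a = g
      · subst hf hg
        have h1 := congrArg star ((X.mnConj a).rbar_mem (star (x c d a b : ℳ)))
        have h2 := (X.mnConj c).conj_left
        have h3 := congrArg star (X.mnConj a).conj_left
        simp only [StarAlgHom.comp_apply, StarAlgHom.coe_id, id_eq, star_mul, star_star, map_star,
          star_one] at h1 h2 h3
        simp only [and_self, if_true]
        calc _ = (X.mn c (star (X.r c)) * (X.mnConj c).rbar)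
              * (star (X.mnConj a).rbar * X.mn a (X.mnBar a (x c d a b : ℳ)))
              * X.mn a (X.r a) := by simp only [mul_assoc]
          _ = (x c d a b : ℳ) := by
            rw [← h1, map_star, h2, one_mul, mul_assoc, h3, mul_one]
      · simp [hg]
    · simp [hf]
  simp only [h]
  simp

theorem mul_one_aux (x : DTA X) : x * 1 = x := by
  classical
  ext c d a b
  rw [mul_apply]
  have h : ∀ f g : X.MN, X.mn c (star (X.r f)) * ((x c f a g : ℳ)
      * X.mn a (X.mnBar g ((1 : DTA X) f d g b : ℳ))) * X.mn a (X.r g)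
      = if f = d then (if g = b then (x c f a g : ℳ) else 0) else 0 := by
    intro f g
    rw [one_apply]
    by_cases hf : f = d
    · by_cases hg : g = b
      · subst hf hg
        have h1 := (x c f a g).2 (X.mnConj f).rbar
        have h2 := congrArg star (X.mnConj f).conj_right
        have h3 := (X.mnConj g).conj_right
        simp only [StarAlgHom.comp_apply, star_mul, star_star, map_star,
          star_one] at h1 h2 h3
        simp only [and_self, if_true]
        calc _ = X.mn c (star (X.r f)) * ((x c f a g : ℳ)
              * X.mn a (X.mnBar g (X.mnConj f).rbar))
              * X.mn a (X.mnBar g (star (X.mnConj g).rbar) * X.r g) := by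
              simp only [mul_assoc, map_mul]
          _ = X.mn c (star (X.r f) * X.mnBar f (X.mnConj f).rbar) * (x c f a g : ℳ)
              * X.mn a (X.mnBar g (star (X.mnConj g).rbar) * X.r g) := by
              rw [h1]; simp only [mul_assoc, map_mul]
          _ = (x c f a g : ℳ) := by
            rw [map_star, h2, h3]; simp
      · simp [hg]
    · simp [hf]
  simp only [h]
  simp

theorem mul_assoc_aux (x y z : DTA X) : x * y * z = x * (y * z) := by
  ext c d a b
  have key : ∀ p q f g : X.MN,
      X.mn c (star (X.r p)) * ((X.mn c (star (X.r f)) * ((x c f a g : ℳ)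
        * X.mn a (X.mnBar g (y f p g q : ℳ))) * X.mn a (X.r g))
        * X.mn a (X.mnBar q (z p d q b : ℳ))) * X.mn a (X.r q)
      = X.mn c (star (X.r f)) * ((x c f a g : ℳ) * X.mn a (X.mnBar g
        (X.mn f (star (X.r p)) * ((y f p g q : ℳ) * X.mn g (X.mnBar q (z p d q b : ℳ)))
          * X.mn g (X.r q)))) * X.mn a (X.r g) := by
    intro p q f g
    have h1 := (x c f a g).2 (X.mn f (star (X.r p)))
    have h2 := congrArg star ((X.mnConj f).r_mem (X.r p))
    have h3 := (X.mnConj g).r_mem (X.mnBar q (z p d q b : ℳ) * X.r q)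
    simp only [StarAlgHom.comp_apply, StarAlgHom.coe_id, id_eq, star_mul, ← map_star]
      at h1 h2 h3
    symm
    calc _ = X.mn c (star (X.r f)) * ((x c f a g : ℳ)
            * X.mn a (X.mnBar g (X.mn f (star (X.r p)))))
            * X.mn a (X.mnBar g (y f p g q : ℳ))
            * X.mn a (X.mnBar g (X.mn g (X.mnBar q (z p d q b : ℳ) * X.r q)) * X.r g) := by
          simp only [mul_assoc, map_mul]
      _ = X.mn c (star (X.r f) * X.mnBar f (X.mn f (star (X.r p)))) * (x c f a g : ℳ)
            * X.mn a (X.mnBar g (y f p g q : ℳ))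
            * X.mn a (X.r g * (X.mnBar q (z p d q b : ℳ) * X.r q)) := by
          rw [h1, ← h3]; simp only [mul_assoc, map_mul]
      _ = _ := by rw [← h2]; simp only [mul_assoc, map_mul]
  simp only [mul_apply, Finset.mul_sum, Finset.sum_mul, map_sum, ← key]
  have swap : ∀ F : X.MN → X.MN → X.MN → X.MN → ℳ,
      ∑ p, ∑ q, ∑ f, ∑ g, F p q f g = ∑ f, ∑ g, ∑ p, ∑ q, F p q f g := by
    intro F
    calc _ = ∑ p, ∑ f, ∑ q, ∑ g, F p q f g := Finset.sum_congr rfl fun p _ => Finset.sum_comm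
      _ = ∑ f, ∑ p, ∑ q, ∑ g, F p q f g := Finset.sum_comm
      _ = ∑ f, ∑ p, ∑ g, ∑ q, F p q f g := Finset.sum_congr rfl fun f _ =>
          Finset.sum_congr rfl fun p _ => Finset.sum_comm
      _ = _ := Finset.sum_congr rfl fun f _ => Finset.sum_comm
  exact swap _

instance : Ring (DTA X) where
  __ := (inferInstance : AddCommGroup (DTA X))
  mul := (· * ·)
  one := 1
  mul_assoc := mul_assoc_aux
  one_mul := one_mul_aux
  mul_one := mul_one_aux
  left_distrib x y z := by
    ext c d a b
    simp only [mul_apply, add_apply, map_add, mul_add, add_mul, Finset.sum_add_distrib]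
  right_distrib x y z := by
    ext c d a b
    simp only [mul_apply, add_apply, mul_add, add_mul, Finset.sum_add_distrib]
  zero_mul x := by
    ext c d a b
    simp [mul_apply, zero_apply]
  mul_zero x := by
    ext c d a b
    simp [mul_apply, zero_apply]

instance : Algebra ℂ (DTA X) :=
  Algebra.ofModule
    (fun z x y => by
      ext c d a b
      change ((z • x * y : DTA X) c d a b : ℳ) = z • ((x * y : DTA X) c d a b : ℳ)
      simp only [mul_apply, smul_apply, Finset.smul_sum, smul_mul_assoc, mul_smul_comm])
    (fun z x y => by
      ext c d a b
      change ((x * z • y : DTA X) c d a b : ℳ) = z • ((x * y : DTA X) c d a b : ℳ)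
      simp only [mul_apply, smul_apply, Finset.smul_sum, smul_mul_assoc, mul_smul_comm, map_smul])

open Classical in
/-- The element `(d_a d_b d_c d_d)^{1/4} s t*` of the summand `Hom(c d̄, a b̄)`, for
`s ∈ Hom(c d̄, B)` and `t ∈ Hom(a b̄, B)`. -/
def e {c d a b : X.MN} {B : X.MM} {s t : ℳ}
    (hs : s ∈ Hom (X.abar c d) (X.mm B)) (ht : t ∈ Hom (X.abar a b) (X.mm B)) : DTA X :=
  fun c₁ d₁ a₁ b₁ =>
    ⟨if c₁ = c ∧ d₁ = d ∧ a₁ = a ∧ b₁ = b then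
        (((X.dMN a * X.dMN b * X.dMN c * X.dMN d) ^ (1 / 4 : ℝ) : ℝ) : ℂ) • (s * star t)
      else 0, by
      split_ifs with h
      · obtain ⟨rfl, rfl, rfl, rfl⟩ := h
        refine Submodule.smul_mem _ _ fun m => ?_
        have h1 := hs m
        have h2 := congrArg star (ht (star m))
        simp only [star_mul, star_star, map_star] at h1 h2 ⊢
        rw [mul_assoc, ← h2, ← mul_assoc, h1, mul_assoc]
      · exact Submodule.zero_mem _⟩

end DTA

/-! ### Paths, symbols and matrix product operators -/

/-- A choice of orthonormal bases of the spaces of intertwiners that enter the construction. -/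
structure BasisChoice (X : EndoSystem ι) where
  /-- basis of `Hom(a ῑ, M)` -/
  odd : X.MN → X.MM → Finset ℳ
  odd_onb : ∀ a M, IsONB ((X.mn a).comp X.iotaBar) (X.mm M) (odd a M)
  /-- basis of `Hom(M ι, a)` -/
  even : X.MM → X.MN → Finset ℳ
  even_onb : ∀ M a, IsONB ((X.mm M).comp ι) (X.mn a) (even M a)
  /-- basis of `Hom(B M₁, M₂)` -/
  fuseMM : X.MM → X.MM → X.MM → Finset ℳ
  fuseMM_onb : ∀ B M₁ M₂, IsONB ((X.mm B).comp (X.mm M₁)) (X.mm M₂) (fuseMM B M₁ M₂)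
  /-- basis of `Hom(B a₁, a₂)` -/
  fuseMN : X.MM → X.MN → X.MN → Finset ℳ
  fuseMN_onb : ∀ B a₁ a₂, IsONB ((X.mm B).comp (X.mn a₁)) (X.mn a₂) (fuseMN B a₁ a₂)
  /-- basis of `Hom(a b̄, B)` -/
  tri : X.MN → X.MN → X.MM → Finset ℳ
  tri_onb : ∀ a b B, IsONB (X.abar a b) (X.mm B) (tri a b B)

variable {X : EndoSystem ι}

/-- The paths of length `L = 2k` which start and end in `ℳ-𝒩` objects: objects
`a₀, M₁, a₂, M₃, …, M_{2k-1}, a_{2k}` and basis intertwiners `t₁ ∈ Hom(a₀ ῑ, M₁)`,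
`t₂ ∈ Hom(M₁ ι, a₂)`, …, `t_{2k} ∈ Hom(M_{2k-1} ι, a_{2k})`. Here `a i` is `a_{2i}`, `M i` is
`M_{2i+1}`, `t i` is `t_{2i+1}` and `u i` is `t_{2i+2}`. -/
@[ext]
structure Path (T : BasisChoice X) (k : ℕ) where
  a : Fin (k + 1) → X.MN
  M : Fin k → X.MM
  t : Fin k → ℳ
  u : Fin k → ℳ
  t_mem : ∀ i, t i ∈ T.odd (a i.castSucc) (M i)
  u_mem : ∀ i, u i ∈ T.even (M i) (a i.succ)

instance (T : BasisChoice X) (k : ℕ) : Finite (Path T k) := by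
  let S := (a : Fin (k + 1) → X.MN) × (M : Fin k → X.MM) ×
    ((i : Fin k) → T.odd (a i.castSucc) (M i)) × ((i : Fin k) → T.even (M i) (a i.succ))
  let f : S → Path T k := fun p =>
    ⟨p.1, p.2.1, fun i => p.2.2.1 i, fun i => p.2.2.2 i, fun i => (p.2.2.1 i).2,
      fun i => (p.2.2.2 i).2⟩
  exact Finite.of_surjective f fun P =>
    ⟨⟨P.a, P.M, fun i => ⟨P.t i, P.t_mem i⟩, fun i => ⟨P.u i, P.u_mem i⟩⟩, rfl⟩

instance (T : BasisChoice X) (k : ℕ) : Fintype (Path T k) := Fintype.ofFinite _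

/-- The space of states of the open chain: the vector space with basis vectors `|P⟩` labelled
by the paths `P`. -/
abbrev OpenChain (T : BasisChoice X) (k : ℕ) : Type _ := Path T k → ℂ

/-- The `6j`-symbol `U_B = [(left × 1) bottom]* (1_B × top) right`, for `top ∈ Hom(a₁ ῑ, M₁)`,
`left ∈ Hom(B a₁, a₂)`, `right ∈ Hom(B M₁, M₂)`, `bottom ∈ Hom(a₂ ῑ, M₂)`. -/
def symbolU (B : X.MM) (top left right bottom : ℳ) : ℂ :=
  scalar (star (left * bottom) * X.mm B top * right)

/-- The `6j`-symbol `Ū_B = [(left × 1) bottom]* (1_B × top) right`, for `top ∈ Hom(M₁ ι, a₁)`,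
`left ∈ Hom(B M₁, M₂)`, `right ∈ Hom(B a₁, a₂)`, `bottom ∈ Hom(M₂ ι, a₂)`. -/
def symbolUbar (B : X.MM) (top left right bottom : ℳ) : ℂ :=
  scalar (star (left * bottom) * X.mm B top * right)

/-- The boundary symbol `Z = u₂* (t* × u₃*) (1_a × r_b × 1) u₁`, for `t ∈ Hom(a b̄, B)`,
`u₁ ∈ Hom(a ῑ, A₁)`, `u₂ ∈ Hom(B A₂, A₁)`, `u₃ ∈ Hom(b ῑ, A₂)`. -/
def symbolZ (a b : X.MN) (t u₃ u₂ u₁ : ℳ) : ℂ :=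
  scalar (star u₂ * dhr (X.abar a b) (star t) (star u₃) * X.mn a (X.r b) * u₁)

/-- The Frobenius dual `(d_b / d_M)^{-1/2} (t* × 1) (1_M × rbar_ι) ∈ Hom(b ῑ, M)` of
`t ∈ Hom(M ι, b)`. -/
def frobenius (M : X.MM) (b : X.MN) (t : ℳ) : ℳ :=
  (((X.dMN b / X.dMM M) ^ (-(1 / 2) : ℝ) : ℝ) : ℂ) • (star t * X.mm M X.iotaConj.rbar)

open Classical in
/-- The matrix element `(E^{b',a',s}_{B;b,a,t})^P_Q` on the chain of length `L = 2k`, `k = m + 1`,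
with `aL = a'`, `bL = b'`, `aR = a`, `bR = b`. The path `P` runs from `b'` to `b`, the path `Q`
from `a'` to `a`. The first site carries a boundary symbol, the sites `2, …, L - 1` carry the
symbols `Ū_B` and `U_B` in turn, the last site (its intertwiners turned into their Frobenius
duals) carries a boundary symbol, and the `L - 1` bonds are summed over orthonormal bases. -/
def matrixE (T : BasisChoice X) (m : ℕ) (B : X.MM) (aL bL aR bR : X.MN) (s t : ℳ)
    (P Q : Path T (m + 1)) : ℂ :=
  if P.a 0 = bL ∧ P.a (Fin.last (m + 1)) = bR ∧ Q.a 0 = aL ∧ Q.a (Fin.last (m + 1)) = aR then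
    (((X.dMN aR * X.dMN bR * X.dMN aL * X.dMN bL) ^ (1 / 4 : ℝ) : ℝ) : ℂ) *
    ∑ p ∈ Fintype.piFinset (fun i : Fin (m + 1) => T.fuseMM B (P.M i) (Q.M i)),
    ∑ q ∈ Fintype.piFinset (fun i : Fin m =>
        T.fuseMN B (P.a i.castSucc.succ) (Q.a i.castSucc.succ)),
      (starRingEnd ℂ) (symbolZ aL bL s (P.t 0) (p 0) (Q.t 0)) *
      (∏ i : Fin m,
        symbolUbar B (P.u i.castSucc) (p i.castSucc) (q i) (Q.u i.castSucc) *
        symbolU B (P.t i.succ) (q i) (p i.succ) (Q.t i.succ)) *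
      symbolZ aR bR t
        (frobenius (P.M (Fin.last m)) bR (P.u (Fin.last m)))
        (p (Fin.last m))
        (frobenius (Q.M (Fin.last m)) aR (Q.u (Fin.last m)))
  else 0

open Classical in
/-- The matrix product operator with `E |P⟩ = ∑_Q E^P_Q |Q⟩`. -/
def mpo (T : BasisChoice X) (m : ℕ) (B : X.MM) (aL bL aR bR : X.MN) (s t : ℳ) :
    Module.End ℂ (OpenChain T (m + 1)) :=
  Matrix.toLin' (Matrix.of fun Q P => matrixE T m B aL bL aR bR s t P Q)

end

end DoubleTriangle

/-!
A path `P` from `f` to `g` is read as the product `t₁ t₂ ⋯ t_L ∈ Hom(f (ῑ ι)^k, g)` of its basis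
intertwiners (`Path.amp`). All constituents of `a ῑ` and of `M ι` lie in the given systems, so the
products belonging to the paths from `f` to `g` form an orthonormal basis of this intertwiner space
(`Path.star_amp_mul_amp_of_ne`, `Path.sum_amp_mul_star_mul`). The chain of paths is thereby
identified with the sum over `f`, `g` of the spaces `Hom(f (ῑ ι)^k, g)`.

On this sum the double triangle algebra acts by the formula of its own product: an element `x` of
`Hom(c d̄, a b̄)` sends `y ∈ Hom(d (ῑ ι)^k, b)` to `(1_c × r_d* × 1)(x × y)(1_a × r_b × 1)`. That this is
a unital action is proved by the same conjugacy equations that make the product associative and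
unital (`EndoSystem.act_mul`, `EndoSystem.act_one`).

It remains to compare the matrix elements of the action with the matrix product operators. In the
bulk, the sums `∑ s s*` over the bonds reproduce the action (`sum_chain`). At the last site the
boundary symbol contains Frobenius duals, and it equals the expected scalar up to the factor
`(d_M / d_b)^{1/2} / (d_M' / d_a)^{1/2}` (`symbolZ_frobenius`). This factor is a quotient of a number
attached to `P` and the same number attached to `P'`, so the matrix product operators are the
matrices of the action conjugated by a diagonal matrix, which is again a representation (`rep`).

The boundary computation rests on the fact that Frobenius duality `Hom(M ι, a) → Hom(a ῑ, M)` maps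
orthonormal bases to multiples of orthonormal bases (`partial_trace_mul_star`). This is a form of
the trace property: the composed solution of the conjugacy relations for `M ι` is spherical because
`M` and `ι` are irreducible (`isSpherical_comp`), and for spherical solutions the left and the right
transposes coincide, because their Gram matrix is positive and inverse to itself
(`star_transpose_eq`).

Uniqueness holds because the elements `e` span the algebra (`span_e_eq_top`): `a b̄` decomposes
in the `ℳ-ℳ` system. The decompositions needed are obtained from the hypotheses by means of the
predicate `IsGenerated`, which is stable under composition.
-/

namespace DoubleTriangle

noncomputable section

/-! ### Intertwiners and scalars -/

/-- The positivity of operator algebras that the argument uses: `x* x` is never a negative or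
non-real multiple of the identity, and it vanishes only for `x = 0`. -/
class ProperStar (A : Type*) [Ring A] [StarRing A] [Algebra ℂ A] : Prop where
  nonneg_of_star_mul_self : ∀ (x : A) (c : ℂ), star x * x = c • (1 : A) → ∃ r : ℝ, 0 ≤ r ∧ (r : ℂ) = c
  eq_zero_of_star_mul_self : ∀ x : A, star x * x = 0 → x = 0

theorem scalar_smul_one {B : Type*} [Ring B] [Algebra ℂ B] [Nontrivial B] (c : ℂ) : scalar (c • (1 : B)) = c := by
  have h : ∃ c' : ℂ, c • (1 : B) = c' • (1 : B) := ⟨c, rfl⟩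
  rw [scalar, dif_pos h]
  have := h.choose_spec
  exact (smul_left_injective ℂ (one_ne_zero (α := B)) this).symm

theorem scalar_zero {B : Type*} [Ring B] [Algebra ℂ B] [Nontrivial B] : scalar (0 : B) = 0 := by
  simpa using scalar_smul_one (B := B) 0

theorem scalar_one {B : Type*} [Ring B] [Algebra ℂ B] [Nontrivial B] : scalar (1 : B) = 1 := by
  simpa using scalar_smul_one (B := B) 1

section Calculus

variable {A B C D : Type*}
  [Ring A] [StarRing A] [Algebra ℂ A]
  [Ring B] [StarRing B] [Algebra ℂ B]
  [Ring C] [StarRing C] [Algebra ℂ C]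
  [Ring D] [StarRing D] [Algebra ℂ D]

theorem Hom.apply {ν μ : A →⋆ₐ[ℂ] B} {t : B} (h : t ∈ Hom ν μ) (x : A) :
    t * μ x = ν x * t := h x

theorem Hom.one_mem (μ : A →⋆ₐ[ℂ] B) : (1 : B) ∈ Hom μ μ := fun x => by simp

theorem Hom.mul_mem {ν σ μ : A →⋆ₐ[ℂ] B} {s t : B} (hs : s ∈ Hom ν σ) (ht : t ∈ Hom σ μ) :
    s * t ∈ Hom ν μ := fun x => by
  rw [mul_assoc, Hom.apply ht, ← mul_assoc, Hom.apply hs, mul_assoc]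

theorem Hom.star_mem {ν μ : A →⋆ₐ[ℂ] B} {t : B} (h : t ∈ Hom ν μ) : star t ∈ Hom μ ν := fun x => by
  have := congrArg star (h (star x))
  simp only [star_mul, ← map_star, star_star] at this
  exact this.symm

theorem Hom.map_mem {ν μ : A →⋆ₐ[ℂ] B} {t : B} (h : t ∈ Hom ν μ) (τ : B →⋆ₐ[ℂ] C) :
    τ t ∈ Hom (τ.comp ν) (τ.comp μ) := fun x => by
  simp only [StarAlgHom.comp_apply, ← map_mul, Hom.apply h]

theorem Hom.whisker {ν μ : B →⋆ₐ[ℂ] C} {t : C} (h : t ∈ Hom ν μ) (τ : A →⋆ₐ[ℂ] B) :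
    t ∈ Hom (ν.comp τ) (μ.comp τ) := fun x => h (τ x)

theorem IsIrred.eq_scalar [Nontrivial B] {μ : A →⋆ₐ[ℂ] B} (h : IsIrred μ) {t : B}
    (ht : t ∈ Hom μ μ) : t = scalar t • (1 : B) := by
  obtain ⟨c, rfl⟩ := h t ht
  rw [scalar_smul_one]

theorem IsIrred.scalar_add [Nontrivial B] {μ : A →⋆ₐ[ℂ] B} (h : IsIrred μ) {s t : B}
    (hs : s ∈ Hom μ μ) (ht : t ∈ Hom μ μ) : scalar (s + t) = scalar s + scalar t := by
  obtain ⟨c, rfl⟩ := h s hs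
  obtain ⟨d, rfl⟩ := h t ht
  rw [← add_smul]
  simp only [scalar_smul_one]

theorem IsIrred.scalar_smul [Nontrivial B] {μ : A →⋆ₐ[ℂ] B} (h : IsIrred μ) {t : B}
    (ht : t ∈ Hom μ μ) (z : ℂ) : scalar (z • t) = z * scalar t := by
  obtain ⟨d, rfl⟩ := h t ht
  rw [smul_smul]
  simp only [scalar_smul_one]

theorem IsIrred.scalar_sum [Nontrivial B] {μ : A →⋆ₐ[ℂ] B} (h : IsIrred μ) {J : Type*}
    (S : Finset J) {f : J → B} (hf : ∀ j ∈ S, f j ∈ Hom μ μ) :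
    scalar (∑ j ∈ S, f j) = ∑ j ∈ S, scalar (f j) := by
  classical
  induction S using Finset.induction_on with
  | empty => simp [scalar_zero]
  | insert j S hj ih =>
    rw [Finset.sum_insert hj, Finset.sum_insert hj,
      h.scalar_add (hf j (by simp)) (Submodule.sum_mem _ fun i hi => hf i (by simp [hi])),
      ih fun i hi => hf i (by simp [hi])]

theorem IsIrred.scalar_star [Nontrivial B] [StarModule ℂ B] {μ : A →⋆ₐ[ℂ] B} (h : IsIrred μ)
    {t : B} (ht : t ∈ Hom μ μ) : scalar (star t) = (starRingEnd ℂ) (scalar t) := by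
  obtain ⟨d, rfl⟩ := h t ht
  rw [star_smul, star_one, scalar_smul_one, scalar_smul_one]
  rfl

/-- Schur's lemma: there are no intertwiners between inequivalent irreducible objects. A nonzero
intertwiner has `x* x` and `x x*` scalar, so that a multiple of it is unitary. -/
theorem eq_zero_of_not_equivalent [Nontrivial B] [StarModule ℂ B] [ProperStar B]
    {ν μ : A →⋆ₐ[ℂ] B} (hν : IsIrred ν) (hμ : IsIrred μ) (hne : ¬ Equivalent ν μ) {x : B}
    (hx : x ∈ Hom ν μ) : x = 0 := by
  by_contra h0
  obtain ⟨c, hc⟩ := hμ _ (Hom.mul_mem (Hom.star_mem hx) hx)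
  obtain ⟨c', hc'⟩ := hν _ (Hom.mul_mem hx (Hom.star_mem hx))
  obtain ⟨r, hr0, hrc⟩ := ProperStar.nonneg_of_star_mul_self x c hc
  have hcne : c ≠ 0 := by
    rintro rfl
    exact h0 (ProperStar.eq_zero_of_star_mul_self x (by simpa using hc))
  have hcc : c' = c := by
    have h1 : c • x = c' • x := by
      calc c • x = x * (star x * x) := by rw [hc]; simp
        _ = c' • x := by rw [← mul_assoc, hc']; simp
    exact (smul_left_injective ℂ h0 h1).symm
  subst hcc
  subst hrc
  have hr : 0 < r := lt_of_le_of_ne hr0 fun h => hcne (by simp [← h])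
  have hs : ((Real.sqrt r : ℂ)⁻¹ * ((Real.sqrt r : ℂ)⁻¹ * r)) = 1 := by
    have : (Real.sqrt r : ℂ) * (Real.sqrt r : ℂ) = r := by
      rw [← Complex.ofReal_mul, Real.mul_self_sqrt hr.le]
    rw [← this]
    have h3 : (Real.sqrt r : ℂ) ≠ 0 := by
      simpa using (Real.sqrt_pos.mpr hr).ne'
    field_simp
  refine hne ⟨(Real.sqrt r : ℂ)⁻¹ • x, Submodule.smul_mem _ _ hx, ?_, ?_⟩
  · rw [star_smul, smul_mul_smul_comm, hc, smul_smul, star_inv₀]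
    simp [mul_assoc, hs]
  · rw [star_smul, smul_mul_smul_comm, hc', smul_smul, star_inv₀]
    simp [mul_assoc, hs]

/-! ### Orthonormal bases -/

/-- Expansion of an intertwiner in an orthonormal basis. -/
theorem IsONB.sum_mul_star_mul {ν μ : A →⋆ₐ[ℂ] B} {T : Finset B} (h : IsONB ν μ T) {x : B}
    (hx : x ∈ Hom ν μ) : (∑ t ∈ T, t * star t) * x = x := by
  rw [← h.span_eq] at hx
  induction hx using Submodule.span_induction with
  | mem x hx =>
    rw [Finset.sum_mul, Finset.sum_eq_single_of_mem x hx]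
    · rw [mul_assoc, h.isometry x hx, mul_one]
    · intro t ht hne
      rw [mul_assoc, h.orthogonal t ht x hx hne, mul_zero]
  | zero => simp
  | add x y _ _ hx hy => rw [mul_add, hx, hy]
  | smul c x _ hx => rw [mul_smul_comm, hx]

theorem IsONB.mul_sum_mul_star {ν μ : A →⋆ₐ[ℂ] B} {T : Finset B} (h : IsONB ν μ T) {x : B}
    (hx : x ∈ Hom μ ν) : x * (∑ t ∈ T, t * star t) = x := by
  have := congrArg star (h.sum_mul_star_mul (Hom.star_mem hx))
  simpa [star_sum] using this

/-! ### Conjugates -/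

namespace Conjugate

variable {a : A →⋆ₐ[ℂ] B} (c : Conjugate a)

theorem r_apply (x : A) : c.bar (a x) * c.r = c.r * x := (c.r_mem x).symm

theorem star_r_apply (x : A) : star c.r * c.bar (a x) = x * star c.r :=
  Hom.star_mem c.r_mem x

theorem rbar_apply (x : B) : a (c.bar x) * c.rbar = c.rbar * x := (c.rbar_mem x).symm

theorem star_rbar_apply (x : B) : star c.rbar * a (c.bar x) = x * star c.rbar :=
  Hom.star_mem c.rbar_mem x

theorem conj_left_star : star c.rbar * a c.r = 1 := by
  simpa [map_star] using congrArg star c.conj_left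

theorem conj_right_star : star c.r * c.bar c.rbar = 1 := by
  simpa [map_star] using congrArg star c.conj_right

theorem d_pos [Nontrivial A] [Nontrivial B] [ProperStar A] : 0 < c.d := by
  obtain ⟨r, h, hr⟩ := ProperStar.nonneg_of_star_mul_self _ _ c.norm_r
  rw [Complex.ofReal_inj] at hr
  subst hr
  refine lt_of_le_of_ne h fun h0 => ?_
  have h1 : star c.r * c.r = 0 := by rw [c.norm_r, ← h0, Complex.ofReal_zero, zero_smul]
  have h2 := ProperStar.eq_zero_of_star_mul_self _ h1
  have h3 := c.conj_left
  rw [h2] at h3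
  simp at h3

/-- The conjugate of a composition, with the composed solution of the conjugacy relations. -/
def comp {a : A →⋆ₐ[ℂ] B} {b : B →⋆ₐ[ℂ] C} (cb : Conjugate b) (ca : Conjugate a) :
    Conjugate (b.comp a) where
  bar := ca.bar.comp cb.bar
  r := ca.bar cb.r * ca.r
  rbar := b ca.rbar * cb.rbar
  d := cb.d * ca.d
  r_mem x := by
    simp only [StarAlgHom.comp_apply, StarAlgHom.coe_id, id_eq]
    rw [mul_assoc, ← ca.r_apply, ← mul_assoc, ← mul_assoc, ← map_mul, ← map_mul, cb.r_apply]
  rbar_mem x := by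
    simp only [StarAlgHom.comp_apply, StarAlgHom.coe_id, id_eq]
    rw [mul_assoc, ← cb.rbar_apply, ← mul_assoc, ← mul_assoc, ← map_mul, ← map_mul, ca.rbar_apply]
  conj_left := by
    simp only [StarAlgHom.comp_apply, star_mul, map_mul]
    rw [mul_assoc, ← mul_assoc (b (a (star (ca.bar cb.r)))), ← map_mul b, ← map_star ca.bar,
      ca.rbar_apply, map_mul, ← mul_assoc, ← mul_assoc, ← map_mul b, ca.conj_left, map_one,
      one_mul, cb.conj_left]
  conj_right := by
    simp only [StarAlgHom.comp_apply, star_mul, map_mul]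
    rw [mul_assoc, ← mul_assoc (ca.bar (cb.bar (star (b ca.rbar)))), ← map_mul ca.bar,
      ← map_star b, cb.r_apply, map_mul, ← mul_assoc, ← mul_assoc, ← map_mul ca.bar,
      cb.conj_right, map_one, one_mul, ca.conj_right]
  norm_r := by
    rw [star_mul, mul_assoc, ← mul_assoc (star (ca.bar cb.r)), ← map_star, ← map_mul, cb.norm_r,
      map_smul, map_one, smul_mul_assoc, one_mul, mul_smul_comm, ca.norm_r, smul_smul,
      Complex.ofReal_mul]
  norm_rbar := by
    rw [star_mul, mul_assoc, ← mul_assoc (star (b ca.rbar)), ← map_star, ← map_mul, ca.norm_rbar,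
      map_smul, map_one, smul_mul_assoc, one_mul, mul_smul_comm, cb.norm_rbar, smul_smul,
      Complex.ofReal_mul, mul_comm]

end Conjugate

/-! ### Transposition and sphericality -/

/-- The transpose `(r_ρ* × 1)(1 × f × 1)(1 × rbar_a) ∈ Hom(ā, ρ̄)` of `f ∈ Hom(ρ, a)`. -/
def transpose {a ρ : A →⋆ₐ[ℂ] B} (ca : Conjugate a) (cρ : Conjugate ρ) (f : B) : A :=
  star cρ.r * cρ.bar (f * ca.rbar)

section Transpose

variable {a ρ σ : A →⋆ₐ[ℂ] B} (ca : Conjugate a) (cρ : Conjugate ρ) (cσ : Conjugate σ)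

theorem transpose_mem {f : B} (hf : f ∈ Hom ρ a) : transpose ca cρ f ∈ Hom ca.bar cρ.bar := by
  intro x
  rw [transpose, mul_assoc, ← map_mul, mul_assoc, ← ca.rbar_apply, ← mul_assoc f, Hom.apply hf,
    mul_assoc, map_mul, ← mul_assoc, cρ.star_r_apply, mul_assoc]

/-- Transposition is a contravariant functor. -/
theorem transpose_mul {f g : B} (hg : g ∈ Hom σ ρ) :
    transpose ca cσ (g * f) = transpose ca cρ f * transpose cρ cσ g := by
  symm
  calc star cρ.r * cρ.bar (f * ca.rbar) * (star cσ.r * cσ.bar (g * cρ.rbar))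
      = star cσ.r * cσ.bar (σ (star cρ.r * cρ.bar (f * ca.rbar))) * cσ.bar (g * cρ.rbar) := by
        rw [cσ.star_r_apply]; simp only [mul_assoc]
    _ = star cσ.r * cσ.bar (g * (ρ (star cρ.r) * (ρ (cρ.bar (f * ca.rbar)) * cρ.rbar))) := by
        rw [mul_assoc, ← map_mul, ← mul_assoc (σ _), ← Hom.apply hg]
        simp only [map_mul, mul_assoc]
    _ = _ := by
        rw [cρ.rbar_apply, ← mul_assoc (ρ _), cρ.conj_left, one_mul, ← mul_assoc]
        rfl

theorem transpose_one : transpose ca ca 1 = 1 := by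
  rw [transpose, one_mul, ca.conj_right_star]

theorem transpose_sub (f g : B) :
    transpose ca cρ (f - g) = transpose ca cρ f - transpose ca cρ g := by
  simp only [transpose, sub_mul, map_sub, mul_sub]

theorem transpose_smul (z : ℂ) (f : B) :
    transpose ca cρ (z • f) = z • transpose ca cρ f := by
  simp only [transpose, smul_mul_assoc, map_smul, mul_smul_comm]

/-- Transposition is onto: the inverse bends the two legs back. -/
theorem exists_transpose_eq {x : A} (hx : x ∈ Hom ca.bar cρ.bar) :
    ∃ f ∈ Hom ρ a, transpose ca cρ f = x := by
  refine ⟨ρ (star ca.r * x) * cρ.rbar, ?_, ?_⟩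
  · intro y
    rw [mul_assoc, ← cρ.rbar_apply, ← mul_assoc, ← map_mul, mul_assoc (star ca.r), Hom.apply hx,
      ← mul_assoc, ca.star_r_apply, mul_assoc, map_mul, mul_assoc]
  · calc star cρ.r * cρ.bar (ρ (star ca.r * x) * cρ.rbar * ca.rbar)
        = star cρ.r * cρ.bar (ρ (star ca.r * x)) * cρ.bar (cρ.rbar * ca.rbar) := by
          simp only [map_mul, mul_assoc]
      _ = star ca.r * x * (star cρ.r * cρ.bar cρ.rbar) * cρ.bar ca.rbar := by
          rw [cρ.star_r_apply, map_mul]; simp only [mul_assoc]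
      _ = star ca.r * ca.bar ca.rbar * x := by
          rw [cρ.conj_right_star, mul_one, mul_assoc, Hom.apply hx, mul_assoc]
      _ = x := by rw [ca.conj_right_star, one_mul]

/-- The conjugate of an irreducible object is irreducible. -/
theorem IsIrred.bar (h : IsIrred a) : IsIrred ca.bar := by
  intro x hx
  obtain ⟨f, hf, rfl⟩ := exists_transpose_eq ca ca hx
  obtain ⟨c, rfl⟩ := h f hf
  exact ⟨c, by rw [transpose_smul, transpose_one]⟩

/-- `(1 × t*) rbar_ρ` is obtained from `rbar_a` by the transpose of `t*`. -/
theorem star_mul_rbar_eq (t : B) :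
    star t * cρ.rbar = a (transpose cρ ca (star t)) * ca.rbar := by
  rw [transpose, map_mul, mul_assoc, ca.rbar_apply, ← mul_assoc, ca.conj_left, one_mul]

/-- `(1 × t*) r_ρ` is obtained from `r_a` by the adjoint of the transpose of `t`. -/
theorem bar_star_mul_r_eq {t : B} (ht : t ∈ Hom ρ a) :
    cρ.bar (star t) * cρ.r = star (transpose ca cρ t) * ca.r := by
  have h1 : cρ.bar (star t) * cρ.r ∈ Hom (cρ.bar.comp a) (StarAlgHom.id ℂ A) :=
    Hom.mul_mem (Hom.map_mem (Hom.star_mem ht) cρ.bar) cρ.r_mem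
  have h2 := h1 ca.r
  simp only [StarAlgHom.comp_apply, StarAlgHom.coe_id, id_eq] at h2
  rw [transpose, star_mul, star_star, ← map_star, star_mul, map_mul, mul_assoc,
    mul_assoc, ← mul_assoc (cρ.bar (star t)), h2, ← mul_assoc, ← map_mul, ca.conj_left_star, map_one, one_mul]

end Transpose

section Trace

variable [Nontrivial A] [Nontrivial B] [StarModule ℂ A] [StarModule ℂ B] [ProperStar A]
  [ProperStar B] {a ρ : A →⋆ₐ[ℂ] B} (ca : Conjugate a) (cρ : Conjugate ρ)

/-- The left and the right trace of `Hom(ρ, ρ)`, computed with a given solution of the conjugacy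
relations, coincide. -/
def IsSpherical (cρ : Conjugate ρ) : Prop :=
  ∀ x ∈ Hom ρ ρ, ∃ c : ℂ, star cρ.r * cρ.bar x * cρ.r = c • (1 : A) ∧
    star cρ.rbar * x * cρ.rbar = c • (1 : B)

/-- For a spherical solution the left and the right transposes of intertwiners agree. Both are
antiunitary up to the same Gram matrix `G`, and `G` is its own inverse; being positive, it is the
identity. -/
theorem star_transpose_eq (ha : IsIrred a) (hρ : IsSpherical cρ) {t : B} (ht : t ∈ Hom ρ a) :
    star (transpose ca cρ t) = transpose cρ ca (star t) := by
  set w : B → A := fun t => star (transpose ca cρ t) with hw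
  set z : B → A := fun t => transpose cρ ca (star t) with hz
  have hbar := IsIrred.bar ca ha
  have hwm : ∀ {t}, t ∈ Hom ρ a → w t ∈ Hom cρ.bar ca.bar := fun ht =>
    Hom.star_mem (transpose_mem ca cρ ht)
  have hzm : ∀ {t}, t ∈ Hom ρ a → z t ∈ Hom cρ.bar ca.bar := fun ht =>
    transpose_mem cρ ca (Hom.star_mem ht)
  have hd : (ca.d : ℂ) ≠ 0 := by simpa using ca.d_pos.ne'
  have hwsub : ∀ s t, w (s - t) = w s - w t := fun s t => by simp [hw, transpose_sub]
  have hzsub : ∀ s t, z (s - t) = z s - z t := fun s t => by simp [hz, transpose_sub]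
  -- the Gram matrices of the two transposes agree
  have hgram : ∀ {s t}, s ∈ Hom ρ a → t ∈ Hom ρ a → star (w s) * w t = star (z s) * z t := by
    intro s t hs ht
    obtain ⟨g, hg⟩ := hbar _ (Hom.mul_mem (Hom.star_mem (hwm hs)) (hwm ht))
    obtain ⟨h, hh⟩ := hbar _ (Hom.mul_mem (Hom.star_mem (hzm hs)) (hzm ht))
    obtain ⟨c, hc1, hc2⟩ := hρ _ (Hom.mul_mem hs (Hom.star_mem ht))
    have e1 : c • (1 : A) = (g * ca.d) • (1 : A) := by
      rw [← hc1]
      calc star cρ.r * cρ.bar (s * star t) * cρ.r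
          = star (cρ.bar (star s) * cρ.r) * (cρ.bar (star t) * cρ.r) := by
            rw [star_mul, ← map_star, star_star, map_mul]; simp only [mul_assoc]
        _ = star ca.r * (star (w s) * w t) * ca.r := by
            rw [bar_star_mul_r_eq ca cρ hs, bar_star_mul_r_eq ca cρ ht, star_mul]
            simp only [mul_assoc, hw]
        _ = _ := by
            rw [hg, mul_smul_comm, mul_one, smul_mul_assoc, ca.norm_r, smul_smul]
    have e2 : c • (1 : B) = (h * ca.d) • (1 : B) := by
      rw [← hc2]
      calc star cρ.rbar * (s * star t) * cρ.rbar
          = star (star s * cρ.rbar) * (star t * cρ.rbar) := by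
            rw [star_mul, star_star]; simp only [mul_assoc]
        _ = star ca.rbar * a (star (z s) * z t) * ca.rbar := by
            rw [star_mul_rbar_eq ca cρ s, star_mul_rbar_eq ca cρ t, star_mul, ← map_star, map_mul]
            simp only [mul_assoc, hz]
        _ = _ := by
            rw [hh, map_smul, map_one, mul_smul_comm, mul_one, smul_mul_assoc, ca.norm_rbar,
              smul_smul]
    have e3 := smul_left_injective ℂ (one_ne_zero (α := A)) e1
    have e4 := smul_left_injective ℂ (one_ne_zero (α := B)) e2
    have : g = h := mul_right_cancel₀ hd (e3.symm.trans e4)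
    rw [hg, hh, this]
  -- the two transposes are dual to each other
  have hdual : ∀ {s t}, s ∈ Hom ρ a → t ∈ Hom ρ a →
      star (w s) * z t = scalar (star t * s) • (1 : A) := by
    intro s t hs ht
    rw [hw, hz]
    simp only [star_star]
    rw [← transpose_mul ca cρ ca (Hom.star_mem ht)]
    conv_lhs => rw [ha.eq_scalar (Hom.mul_mem (Hom.star_mem ht) hs)]
    rw [transpose_smul, transpose_one]
  have hwsurj : ∀ {x}, x ∈ Hom cρ.bar ca.bar → ∃ s ∈ Hom ρ a, w s = x := by
    intro x hx
    obtain ⟨f, hf, h⟩ := exists_transpose_eq ca cρ (Hom.star_mem hx)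
    exact ⟨f, hf, by rw [hw]; simp [h]⟩
  obtain ⟨f, hf, hfz⟩ := exists_transpose_eq cρ ca (hwm ht)
  -- `t'` is the image of `t` under the Gram matrix
  set t' := star f
  have ht' : t' ∈ Hom ρ a := Hom.star_mem hf
  have h1 : z t' = w t := by simp [hz, t', hfz]
  have h2 : w t' = z t := by
    obtain ⟨s, hs, hsx⟩ := hwsurj (Submodule.sub_mem _ (hwm ht') (hzm ht))
    have key : star (w s) * (w t' - z t) = 0 := by
      have e3 : star (z s) * w t = star (w s) * z t := by
        have e4 : star (z s) * w t = star (star (w t) * z s) := by simp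
        rw [e4, hdual ht hs, hdual hs ht, star_smul, star_one]
        rw [show star t * s = star (star s * t) by simp,
          ha.scalar_star (Hom.mul_mem (Hom.star_mem hs) ht)]
        rfl
      rw [mul_sub, hgram hs ht', h1, e3, sub_self]
    rw [hsx] at key
    exact sub_eq_zero.mp (ProperStar.eq_zero_of_star_mul_self _ key)
  -- on the difference the Gram matrix acts as `-1`
  have hs : t - t' ∈ Hom ρ a := Submodule.sub_mem _ ht ht'
  have h3 : z (t - t') = - w (t - t') := by rw [hwsub, hzsub, h1, h2, neg_sub]
  have h4 := hdual hs hs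
  obtain ⟨c, hc⟩ := ha _ (Hom.mul_mem (Hom.star_mem hs) hs)
  rw [h3, hc, scalar_smul_one, mul_neg, neg_eq_iff_eq_neg, ← neg_smul] at h4
  obtain ⟨r₁, hr₁, p1⟩ := ProperStar.nonneg_of_star_mul_self _ _ h4
  obtain ⟨r₂, hr₂, p2⟩ := ProperStar.nonneg_of_star_mul_self _ _ hc
  have p3 : c = 0 := by
    rw [← p2, ← Complex.ofReal_neg, Complex.ofReal_inj] at p1
    rw [← p2, Complex.ofReal_eq_zero]
    linarith
  have p4 := ProperStar.eq_zero_of_star_mul_self (t - t') (by rw [hc, p3, zero_smul])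
  rw [sub_eq_zero] at p4
  change w t = z t
  rw [← h2, ← p4]

/-- The trace of `s t*`, for `s, t ∈ Hom(ρ, a)` with irreducible `a`, is `d_a (t, s)`. -/
theorem trace_mul_star (ha : IsIrred a) (hρ : IsSpherical cρ) {s t : B} (hs : s ∈ Hom ρ a)
    (ht : t ∈ Hom ρ a) :
    star cρ.rbar * (s * star t) * cρ.rbar = (scalar (star t * s) * ca.d) • (1 : B) := by
  calc star cρ.rbar * (s * star t) * cρ.rbar
      = star (star s * cρ.rbar) * (star t * cρ.rbar) := by
        rw [star_mul, star_star]; simp only [mul_assoc]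
    _ = star ca.rbar * a (transpose ca cρ s * transpose cρ ca (star t)) * ca.rbar := by
        rw [star_mul_rbar_eq ca cρ s, star_mul_rbar_eq ca cρ t, ← star_transpose_eq ca cρ ha hρ hs,
          star_mul, ← map_star, star_star, map_mul]
        simp only [mul_assoc]
    _ = _ := by
        rw [← transpose_mul ca cρ ca (Hom.star_mem ht),
          ha.eq_scalar (Hom.mul_mem (Hom.star_mem ht) hs), transpose_smul, transpose_one,
          map_smul, map_one, mul_smul_comm, mul_one, smul_mul_assoc, ca.norm_rbar, smul_smul,
          scalar_smul_one]

end Trace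

section CompTrace

variable [Nontrivial B] {a : A →⋆ₐ[ℂ] B} {b : B →⋆ₐ[ℂ] C} (ca : Conjugate a) (cb : Conjugate b)

/-- The composed solution for two irreducible objects is spherical: both partial traces are
scalar, and they are proportional because tracing out both factors can be done in either order. -/
theorem isSpherical_comp (ha : IsIrred a) (hb : IsIrred b) : IsSpherical (cb.comp ca) := by
  intro x hx
  have hl : star cb.r * cb.bar x * cb.r ∈ Hom a a := by
    refine Hom.mul_mem (Hom.mul_mem (Hom.star_mem (Hom.whisker cb.r_mem a)) ?_)
      (Hom.whisker cb.r_mem a)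
    exact Hom.map_mem hx cb.bar
  have hr : b (star ca.rbar) * x * b ca.rbar ∈ Hom b b := by
    refine Hom.mul_mem (Hom.mul_mem (Hom.map_mem (Hom.star_mem ca.rbar_mem) b) ?_)
      (Hom.map_mem ca.rbar_mem b)
    exact Hom.whisker hx ca.bar
  obtain ⟨l, hl⟩ := ha _ hl
  obtain ⟨k, hk⟩ := hb _ hr
  have e : (k * cb.d) • (1 : B) = (l * ca.d) • (1 : B) := by
    calc (k * cb.d) • (1 : B) = star cb.r * cb.bar (b (star ca.rbar) * x * b ca.rbar) * cb.r := by
          rw [hk, map_smul, map_one, mul_smul_comm, mul_one, smul_mul_assoc, cb.norm_r, smul_smul]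
      _ = (star cb.r * cb.bar (b (star ca.rbar))) * cb.bar x * (cb.bar (b ca.rbar) * cb.r) := by
          simp only [map_mul, mul_assoc]
      _ = star ca.rbar * (star cb.r * cb.bar x * cb.r) * ca.rbar := by
          rw [cb.r_apply, cb.star_r_apply]; simp only [mul_assoc]
      _ = _ := by
          rw [hl, mul_smul_comm, mul_one, smul_mul_assoc, ca.norm_rbar, smul_smul]
  refine ⟨k * cb.d, ?_, ?_⟩
  · rw [smul_left_injective ℂ (one_ne_zero (α := B)) e]
    change star (ca.bar cb.r * ca.r) * ca.bar (cb.bar x) * (ca.bar cb.r * ca.r) = _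
    calc _ = star ca.r * ca.bar (star cb.r * cb.bar x * cb.r) * ca.r := by
          rw [star_mul, ← map_star]; simp only [map_mul, mul_assoc]
      _ = _ := by
          rw [hl, map_smul, map_one, mul_smul_comm, mul_one, smul_mul_assoc, ca.norm_r, smul_smul]
  · change star (b ca.rbar * cb.rbar) * x * (b ca.rbar * cb.rbar) = _
    calc _ = star cb.rbar * (b (star ca.rbar) * x * b ca.rbar) * cb.rbar := by
          rw [star_mul, ← map_star]; simp only [mul_assoc]
      _ = _ := by
          rw [hk, mul_smul_comm, mul_one, smul_mul_assoc, cb.norm_rbar, smul_smul]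

variable [Nontrivial A] [Nontrivial C] [ProperStar A] [ProperStar B] [ProperStar C]
  [StarModule ℂ A] [StarModule ℂ C] {e : A →⋆ₐ[ℂ] C} (ce : Conjugate e)

/-- Frobenius duality preserves inner products up to the ratio of the dimensions: tracing `s t*`
over `a` alone gives `d_e / d_b` times the inner product `(t, s)`, for `s, t ∈ Hom(b a, e)`. -/
theorem partial_trace_mul_star (ha : IsIrred a) (hb : IsIrred b) (he : IsIrred e) {s t : C}
    (hs : s ∈ Hom (b.comp a) e) (ht : t ∈ Hom (b.comp a) e) :
    b (star ca.rbar) * (s * star t) * b ca.rbar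
      = (scalar (star t * s) * (ce.d / cb.d)) • (1 : C) := by
  have hr : b (star ca.rbar) * (s * star t) * b ca.rbar ∈ Hom b b := by
    refine Hom.mul_mem (Hom.mul_mem (Hom.map_mem (Hom.star_mem ca.rbar_mem) b) ?_)
      (Hom.map_mem ca.rbar_mem b)
    exact Hom.whisker (Hom.mul_mem hs (Hom.star_mem ht)) ca.bar
  obtain ⟨k, hk⟩ := hb _ hr
  have h1 := trace_mul_star ce (cb.comp ca) he (isSpherical_comp ca cb ha hb) hs ht
  have h2 : star (cb.comp ca).rbar * (s * star t) * (cb.comp ca).rbar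
      = (k * cb.d) • (1 : C) := by
    change star (b ca.rbar * cb.rbar) * (s * star t) * (b ca.rbar * cb.rbar) = _
    calc _ = star cb.rbar * (b (star ca.rbar) * (s * star t) * b ca.rbar) * cb.rbar := by
          rw [star_mul, ← map_star]; simp only [mul_assoc]
      _ = _ := by
          rw [hk, mul_smul_comm, mul_one, smul_mul_assoc, cb.norm_rbar, smul_smul]
  have h3 := smul_left_injective ℂ (one_ne_zero (α := C)) (h2.symm.trans h1)
  have hd : (cb.d : ℂ) ≠ 0 := by simpa using cb.d_pos.ne'
  rw [hk, mul_div_assoc', ← h3, mul_div_cancel_right₀ _ hd]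

end CompTrace

end Calculus

section

/-! ### Completeness of the orthonormal bases -/

section Generated

variable {A B C : Type*}
  [Ring A] [StarRing A] [Algebra ℂ A]
  [Ring B] [StarRing B] [Algebra ℂ B]
  [Ring C] [StarRing C] [Algebra ℂ C]

/-- The identity of `σ` is a linear combination of intertwiners that factor through members of
the family `μ`. For operator algebras this says that `σ` is a finite direct sum of subobjects
of the `μ i`; in contrast to `Decomposes`, the `μ i` need not be irreducible. -/
def IsGenerated {I : Type*} (σ : A →⋆ₐ[ℂ] B) (μ : I → (A →⋆ₐ[ℂ] B)) : Prop :=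
  (1 : B) ∈ Submodule.span ℂ {z : B | ∃ i, ∃ x ∈ Hom σ (μ i), ∃ y ∈ Hom (μ i) σ, z = x * y}

variable {I J : Type*}

theorem Decomposes.isGenerated [Fintype I] {σ : A →⋆ₐ[ℂ] B} {μ : I → (A →⋆ₐ[ℂ] B)}
    (h : Decomposes σ μ) : IsGenerated σ μ := by
  obtain ⟨T, hT, h1⟩ := h
  rw [IsGenerated, ← h1]
  exact Submodule.sum_mem _ fun i _ => Submodule.sum_mem _ fun t ht => Submodule.subset_span
    ⟨i, t, (hT i).mem ht, star t, Hom.star_mem ((hT i).mem ht), rfl⟩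

theorem IsGenerated.trans {σ : A →⋆ₐ[ℂ] B} {ρ : J → (A →⋆ₐ[ℂ] B)} {μ : I → (A →⋆ₐ[ℂ] B)}
    (h : IsGenerated σ ρ) (h' : ∀ j, IsGenerated (ρ j) μ) : IsGenerated σ μ := by
  refine Submodule.span_le.mpr ?_ h
  rintro _ ⟨j, x, hx, y, hy, rfl⟩
  suffices H : ∀ w ∈ Submodule.span ℂ
      {z : B | ∃ i, ∃ x ∈ Hom (ρ j) (μ i), ∃ y ∈ Hom (μ i) (ρ j), z = x * y},
      x * w * y ∈ Submodule.span ℂ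
        {z : B | ∃ i, ∃ x ∈ Hom σ (μ i), ∃ y ∈ Hom (μ i) σ, z = x * y} by
    simpa using H 1 (h' j)
  intro w hw
  induction hw using Submodule.span_induction with
  | mem w hw =>
    obtain ⟨i, x', hx', y', hy', rfl⟩ := hw
    exact Submodule.subset_span
      ⟨i, x * x', Hom.mul_mem hx hx', y' * y, Hom.mul_mem hy' hy, by simp only [mul_assoc]⟩
  | zero => simp
  | add v w _ _ hv hw => rw [mul_add, add_mul]; exact Submodule.add_mem _ hv hw
  | smul c w _ hw => rw [mul_smul_comm, smul_mul_assoc]; exact Submodule.smul_mem _ c hw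

theorem IsGenerated.of_mul_eq_one {σ : A →⋆ₐ[ℂ] B} {μ : I → (A →⋆ₐ[ℂ] B)} (i : I) {x y : B}
    (hx : x ∈ Hom σ (μ i)) (hy : y ∈ Hom (μ i) σ) (h : x * y = 1) : IsGenerated σ μ :=
  Submodule.subset_span ⟨i, x, hx, y, hy, h.symm⟩

theorem Equivalent.isGenerated {σ : A →⋆ₐ[ℂ] B} {μ : I → (A →⋆ₐ[ℂ] B)} {i : I}
    (h : Equivalent σ (μ i)) : IsGenerated σ μ := by
  obtain ⟨u, hu, -, h1⟩ := h
  exact .of_mul_eq_one i hu (Hom.star_mem hu) h1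

/-- Constituents are subobjects. -/
theorem exists_mul_eq_one_of_hom_ne_bot [ProperStar B] {σ ρ : A →⋆ₐ[ℂ] B} (hσ : IsIrred σ)
    (h : Hom ρ σ ≠ ⊥) : ∃ x ∈ Hom σ ρ, ∃ y ∈ Hom ρ σ, x * y = 1 := by
  obtain ⟨v, hv, hv0⟩ := Submodule.exists_mem_ne_zero_of_ne_bot h
  obtain ⟨c, hc⟩ := hσ _ (Hom.mul_mem (Hom.star_mem hv) hv)
  have hc0 : c ≠ 0 := by
    rintro rfl
    exact hv0 (ProperStar.eq_zero_of_star_mul_self v (by simpa using hc))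
  refine ⟨c⁻¹ • star v, Submodule.smul_mem _ _ (Hom.star_mem hv), v, hv, ?_⟩
  rw [smul_mul_assoc, hc, smul_smul, inv_mul_cancel₀ hc0, one_smul]

theorem IsGenerated.comp_left {σ : A →⋆ₐ[ℂ] B} {μ : I → (A →⋆ₐ[ℂ] B)} (h : IsGenerated σ μ)
    (τ : B →⋆ₐ[ℂ] C) : IsGenerated (τ.comp σ) fun i => τ.comp (μ i) := by
  have key : ∀ w ∈ Submodule.span ℂ
      {z : B | ∃ i, ∃ x ∈ Hom σ (μ i), ∃ y ∈ Hom (μ i) σ, z = x * y},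
      τ w ∈ Submodule.span ℂ {z : C | ∃ i, ∃ x ∈ Hom (τ.comp σ) (τ.comp (μ i)),
        ∃ y ∈ Hom (τ.comp (μ i)) (τ.comp σ), z = x * y} := by
    intro w hw
    induction hw using Submodule.span_induction with
    | mem w hw =>
      obtain ⟨i, x, hx, y, hy, rfl⟩ := hw
      exact Submodule.subset_span
        ⟨i, τ x, Hom.map_mem hx τ, τ y, Hom.map_mem hy τ, map_mul _ _ _⟩
    | zero => simp
    | add v w _ _ hv hw => rw [map_add]; exact Submodule.add_mem _ hv hw
    | smul c w _ hw => rw [map_smul]; exact Submodule.smul_mem _ c hw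
  have := key 1 h
  rwa [map_one] at this

theorem IsGenerated.comp_right {σ : B →⋆ₐ[ℂ] C} {μ : I → (B →⋆ₐ[ℂ] C)} (h : IsGenerated σ μ)
    (τ : A →⋆ₐ[ℂ] B) : IsGenerated (σ.comp τ) fun i => (μ i).comp τ := by
  refine Submodule.span_mono ?_ h
  rintro _ ⟨i, x, hx, y, hy, rfl⟩
  exact ⟨i, x, Hom.whisker hx τ, y, Hom.whisker hy τ, rfl⟩

/-- If an object is generated by inequivalent irreducible objects, then any orthonormal bases of
the intertwiner spaces are complete. -/
theorem IsGenerated.sum_mul_star_eq_one [Nontrivial B] [StarModule ℂ B] [ProperStar B]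
    [Fintype I] {σ : A →⋆ₐ[ℂ] B} {μ : I → (A →⋆ₐ[ℂ] B)} (h : IsGenerated σ μ)
    (hirr : ∀ i, IsIrred (μ i)) (hne : ∀ i j, Equivalent (μ i) (μ j) → i = j)
    {T : I → Finset B} (hT : ∀ i, IsONB σ (μ i) (T i)) :
    ∑ i, ∑ t ∈ T i, t * star t = 1 := by
  suffices H : ∀ w ∈ Submodule.span ℂ
      {z : B | ∃ i, ∃ x ∈ Hom σ (μ i), ∃ y ∈ Hom (μ i) σ, z = x * y},
      (∑ i, ∑ t ∈ T i, t * star t) * w = w by simpa using H 1 h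
  intro w hw
  induction hw using Submodule.span_induction with
  | mem w hw =>
    obtain ⟨i, x, hx, y, hy, rfl⟩ := hw
    rw [← mul_assoc]
    congr 1
    rw [Finset.sum_mul, Finset.sum_eq_single i]
    · exact (hT i).sum_mul_star_mul hx
    · intro j _ hj
      rw [Finset.sum_mul]
      refine Finset.sum_eq_zero fun t ht => ?_
      rw [mul_assoc, eq_zero_of_not_equivalent (hirr j) (hirr i) (fun e => hj (hne j i e))
        (Hom.mul_mem (Hom.star_mem ((hT j).mem ht)) hx), mul_zero]
    · simp
  | zero => simp
  | add v w _ _ hv hw => rw [mul_add, hv, hw]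
  | smul c w _ hw => rw [mul_smul_comm, hw]

end Generated

variable {𝒩 ℳ : Type*} [Ring 𝒩] [StarRing 𝒩] [Algebra ℂ 𝒩]
  [Ring ℳ] [StarRing ℳ] [Algebra ℂ ℳ] [ProperStar ℳ] {ι : 𝒩 →⋆ₐ[ℂ] ℳ} (X : EndoSystem ι)

namespace EndoSystem

theorem mn_isGenerated (a : X.MN) : IsGenerated (X.mn a) fun i => ι.comp (X.nn i) := by
  obtain ⟨i, hi⟩ := X.mn_appears a
  obtain ⟨x, hx, y, hy, h⟩ := exists_mul_eq_one_of_hom_ne_bot (X.mn_irred a) hi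
  exact .of_mul_eq_one i hx hy h

theorem mm_isGenerated (B : X.MM) :
    IsGenerated (X.mm B) fun i => (ι.comp (X.nn i)).comp X.iotaBar := by
  obtain ⟨i, hi⟩ := X.mm_appears B
  obtain ⟨x, hx, y, hy, h⟩ := exists_mul_eq_one_of_hom_ne_bot (X.mm_irred B) hi
  exact .of_mul_eq_one i hx hy h

/-- The conjugate of a constituent of `ι lam` is a constituent of `lam̄ ῑ`, by transposition. -/
theorem mnBar_isGenerated (b : X.MN) :
    IsGenerated (X.mnBar b) fun i => (X.nn i).comp X.iotaBar := by
  obtain ⟨i, hi⟩ := X.mn_appears b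
  obtain ⟨x, hx, y, hy, h⟩ := exists_mul_eq_one_of_hom_ne_bot (X.mn_irred b) hi
  obtain ⟨j, hj⟩ := X.nn_bar i
  have h1 : IsGenerated (X.mnBar b) fun _ : Unit => (X.nnConj i).bar.comp X.iotaBar := by
    refine .of_mul_eq_one ()
      (transpose_mem (X.mnConj b) (X.iotaConj.comp (X.nnConj i)) hy)
      (transpose_mem (X.iotaConj.comp (X.nnConj i)) (X.mnConj b) hx) ?_
    rw [← transpose_mul _ _ _ hx, h, transpose_one]
  exact h1.trans fun _ => (hj.isGenerated (μ := X.nn)).comp_right X.iotaBar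

/-- `a ῑ` decomposes in the `ℳ-ℳ` system. -/
theorem mn_iotaBar_isGenerated (a : X.MN) :
    IsGenerated ((X.mn a).comp X.iotaBar) X.mm :=
  ((X.mn_isGenerated a).comp_right X.iotaBar).trans fun i => (X.mm_complete i).isGenerated

/-- `M ι` decomposes in the `ℳ-𝒩` system. -/
theorem mm_iota_isGenerated (M : X.MM) : IsGenerated ((X.mm M).comp ι) X.mn := by
  refine ((X.mm_isGenerated M).comp_right ι).trans fun i => ?_
  refine IsGenerated.trans (X.theta.isGenerated.comp_left (ι.comp (X.nn i))) fun j => ?_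
  exact ((X.nn_fusion i j).isGenerated.comp_left ι).trans fun l => (X.mn_complete l).isGenerated

/-- `a b̄` decomposes in the `ℳ-ℳ` system. -/
theorem abar_isGenerated (a b : X.MN) : IsGenerated (X.abar a b) X.mm := by
  refine ((X.mn_isGenerated a).comp_right (X.mnBar b)).trans fun i => ?_
  refine ((X.mnBar_isGenerated b).comp_left (ι.comp (X.nn i))).trans fun j => ?_
  have h := (((X.nn_fusion i j).isGenerated.comp_left ι).comp_right X.iotaBar).trans
    fun l => (X.mm_complete l).isGenerated
  simpa only [StarAlgHom.comp_assoc] using h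

end EndoSystem

namespace BasisChoice

variable [Nontrivial ℳ] [StarModule ℂ ℳ] {X} (T : BasisChoice X)

theorem sum_odd (a : X.MN) : ∑ M, ∑ t ∈ T.odd a M, t * star t = 1 :=
  (X.mn_iotaBar_isGenerated a).sum_mul_star_eq_one X.mm_irred X.mm_inequiv (T.odd_onb a)

theorem sum_even (M : X.MM) : ∑ a, ∑ t ∈ T.even M a, t * star t = 1 :=
  (X.mm_iota_isGenerated M).sum_mul_star_eq_one X.mn_irred X.mn_inequiv (T.even_onb M)

theorem sum_tri (a b : X.MN) : ∑ B, ∑ t ∈ T.tri a b B, t * star t = 1 :=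
  (X.abar_isGenerated a b).sum_mul_star_eq_one X.mm_irred X.mm_inequiv (T.tri_onb a b)

end BasisChoice

end

section

variable {𝒩 ℳ : Type*} [Ring 𝒩] [StarRing 𝒩] [Algebra ℂ 𝒩]
  [Ring ℳ] [StarRing ℳ] [Algebra ℂ ℳ] {ι : 𝒩 →⋆ₐ[ℂ] ℳ} {X : EndoSystem ι}

/-! ### Paths as intertwiners -/

/-- The power `(ῑ ι)^k` of the canonical endomorphism of `𝒩`. -/
def EndoSystem.thetaPow (X : EndoSystem ι) : ℕ → (𝒩 →⋆ₐ[ℂ] 𝒩)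
  | 0 => StarAlgHom.id ℂ 𝒩
  | k + 1 => (X.iotaBar.comp ι).comp (X.thetaPow k)

namespace Path

variable {T : BasisChoice X} {k : ℕ}

/-- The intertwiner `t₁ t₂ ⋯ t_{2k} ∈ Hom(a₀ (ῑ ι)^k, a_{2k})` of a path. -/
def amp (P : Path T k) : ℳ := (List.ofFn fun i => P.t i * P.u i).prod

/-- The path without its first two steps. -/
def tail (P : Path T (k + 1)) : Path T k where
  a i := P.a i.succ
  M i := P.M i.succ
  t i := P.t i.succ
  u i := P.u i.succ
  t_mem i := P.t_mem i.succ
  u_mem i := P.u_mem i.succ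

/-- The path extended by two steps at its beginning. -/
def cons (f : X.MN) (M : X.MM) (t u : ℳ) (P : Path T k) (ht : t ∈ T.odd f M)
    (hu : u ∈ T.even M (P.a 0)) : Path T (k + 1) where
  a := Fin.cons f P.a
  M := Fin.cons M P.M
  t := Fin.cons t P.t
  u := Fin.cons u P.u
  t_mem i := by
    refine Fin.cases ht (fun i => ?_) i
    simpa using P.t_mem i
  u_mem i := by
    refine Fin.cases ?_ (fun i => ?_) i
    · simpa using hu
    · simpa using P.u_mem i

theorem amp_succ (P : Path T (k + 1)) : P.amp = P.t 0 * P.u 0 * P.tail.amp := by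
  rw [amp, List.ofFn_succ, List.prod_cons]
  rfl

theorem amp_zero (P : Path T 0) : P.amp = 1 := by simp [amp]

theorem t_hom (P : Path T k) (i : Fin k) :
    P.t i ∈ Hom ((X.mn (P.a i.castSucc)).comp X.iotaBar) (X.mm (P.M i)) :=
  (T.odd_onb _ _).mem (P.t_mem i)

theorem u_hom (P : Path T k) (i : Fin k) :
    P.u i ∈ Hom ((X.mm (P.M i)).comp ι) (X.mn (P.a i.succ)) :=
  (T.even_onb _ _).mem (P.u_mem i)

/-- The first two steps of a path, as one intertwiner. -/
theorem step_hom (P : Path T (k + 1)) :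
    P.t 0 * P.u 0 ∈ Hom ((X.mn (P.a 0)).comp (X.iotaBar.comp ι)) (X.mn (P.tail.a 0)) :=
  Hom.mul_mem (Hom.whisker (P.t_hom 0) ι) (P.u_hom 0)

theorem amp_mem (P : Path T k) :
    P.amp ∈ Hom ((X.mn (P.a 0)).comp (X.thetaPow k)) (X.mn (P.a (Fin.last k))) := by
  induction k with
  | zero =>
    rw [amp_zero]
    exact Hom.one_mem _
  | succ k ih =>
    rw [amp_succ]
    exact Hom.mul_mem (Hom.whisker P.step_hom (X.thetaPow k)) (ih P.tail)

theorem ext_of_tail {P Q : Path T (k + 1)} (ha : P.a 0 = Q.a 0) (hM : P.M 0 = Q.M 0)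
    (ht : P.t 0 = Q.t 0) (hu : P.u 0 = Q.u 0) (h : P.tail = Q.tail) : P = Q := by
  ext i
  · exact Fin.cases ha (fun i => congrFun (congrArg Path.a h) i) i
  · exact Fin.cases hM (fun i => congrFun (congrArg Path.M h) i) i
  · exact Fin.cases ht (fun i => congrFun (congrArg Path.t h) i) i
  · exact Fin.cases hu (fun i => congrFun (congrArg Path.u h) i) i

theorem star_amp_mul_amp_self (P : Path T k) : star P.amp * P.amp = 1 := by
  induction k with
  | zero => simp [amp_zero]
  | succ k ih =>
    have h1 := (T.odd_onb _ _).isometry _ (P.t_mem 0)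
    have h2 := (T.even_onb _ _).isometry _ (P.u_mem 0)
    calc star P.amp * P.amp
        = star P.tail.amp * (star (P.u 0) * (star (P.t 0) * P.t 0) * P.u 0) * P.tail.amp := by
          rw [amp_succ]; simp only [star_mul, mul_assoc]
      _ = 1 := by rw [h1, mul_one, h2, mul_one, ih]

variable [Nontrivial ℳ] [StarModule ℂ ℳ] [ProperStar ℳ]

theorem star_amp_mul_amp_of_ne {P Q : Path T k} (h0 : P.a 0 = Q.a 0) (hne : P ≠ Q) :
    star P.amp * Q.amp = 0 := by
  induction k with
  | zero =>
    refine absurd ?_ hne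
    ext i
    · rw [Fin.fin_one_eq_zero i, h0]
    · exact i.elim0
    · exact i.elim0
    · exact i.elim0
  | succ k ih =>
    have e : star P.amp * Q.amp
        = star P.tail.amp * (star (P.u 0) * (star (P.t 0) * Q.t 0) * Q.u 0) * Q.tail.amp := by
      rw [amp_succ, amp_succ]; simp only [star_mul, mul_assoc]
    have hPt := P.t_mem 0
    have hQt := Q.t_mem 0
    have hPu := P.u_mem 0
    have hQu := Q.u_mem 0
    have hPh := P.t_hom 0
    have hQh := Q.t_hom 0
    simp only [Fin.castSucc_zero] at hPt hQt hPh hQh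
    rw [h0] at hPt hPh
    rw [e]
    by_cases hM : P.M 0 = Q.M 0
    · rw [hM] at hPt hPu
      by_cases ht : P.t 0 = Q.t 0
      · rw [ht, (T.odd_onb _ _).isometry _ hQt, mul_one]
        by_cases ha : P.tail.a 0 = Q.tail.a 0
        · have ha' : P.a (Fin.succ 0) = Q.a (Fin.succ 0) := ha
          rw [ha'] at hPu
          by_cases hu : P.u 0 = Q.u 0
          · rw [hu, (T.even_onb _ _).isometry _ hQu, mul_one]
            exact ih ha fun h => hne (ext_of_tail h0 hM ht hu h)
          · rw [(T.even_onb _ _).orthogonal _ hPu _ hQu hu, mul_zero, zero_mul]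
        · have h : star (P.u 0) * Q.u 0 = 0 := by
            refine eq_zero_of_not_equivalent (X.mn_irred _) (X.mn_irred _)
              (fun e => ha (X.mn_inequiv _ _ e))
              (Hom.mul_mem (Hom.star_mem (P.u_hom 0)) ?_)
            rw [hM]
            exact Q.u_hom 0
          rw [h, mul_zero, zero_mul]
      · rw [(T.odd_onb _ _).orthogonal _ hPt _ hQt ht]
        simp
    · have h : star (P.t 0) * Q.t 0 = 0 :=
        eq_zero_of_not_equivalent (X.mm_irred _) (X.mm_irred _)
          (fun e => hM (X.mm_inequiv _ _ e)) (Hom.mul_mem (Hom.star_mem hPh) hQh)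
      rw [h]
      simp

open Classical in
/-- The intertwiners of the paths that start at `f` are complete. -/
theorem sum_amp_mul_star (T : BasisChoice X) (k : ℕ) (f : X.MN) :
    ∑ P : Path T k with P.a 0 = f, P.amp * star P.amp = 1 := by
  induction k generalizing f with
  | zero =>
    let P₀ : Path T 0 := ⟨fun _ => f, Fin.elim0, Fin.elim0, Fin.elim0, fun i => i.elim0,
      fun i => i.elim0⟩
    rw [Finset.sum_eq_single P₀]
    · simp [amp_zero]
    · intro P hP hne
      refine absurd ?_ hne
      have := (Finset.mem_filter.mp hP).2
      ext i
      · rw [Fin.fin_one_eq_zero i, this]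
      · exact i.elim0
      · exact i.elim0
      · exact i.elim0
    · simp [P₀]
  | succ k ih =>
    have e : ∑ P : Path T (k + 1) with P.a 0 = f, P.amp * star P.amp
        = ∑ x ∈ (Finset.univ : Finset X.MM).sigma fun M => (T.odd f M).sigma fun _ =>
            (Finset.univ : Finset X.MN).sigma fun b => (T.even M b).sigma fun _ =>
            (Finset.univ : Finset (Path T k)).filter fun P => P.a 0 = b,
          (x.2.1 * x.2.2.2.1 * x.2.2.2.2.amp) * star (x.2.1 * x.2.2.2.1 * x.2.2.2.2.amp) := by
      refine Finset.sum_bij' (fun P _ => ⟨P.M 0, P.t 0, P.tail.a 0, P.u 0, P.tail⟩)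
        (fun x hx => cons f x.1 x.2.1 x.2.2.2.1 x.2.2.2.2 ?_ ?_) ?_ ?_ ?_ ?_ ?_
      · simp only [Finset.mem_sigma] at hx
        exact hx.2.1
      · simp only [Finset.mem_sigma, Finset.mem_filter] at hx
        rw [hx.2.2.2.2.2]
        exact hx.2.2.2.1
      · intro P hP
        have h0 := (Finset.mem_filter.mp hP).2
        simp only [Finset.mem_sigma, Finset.mem_filter, Finset.mem_univ, true_and, and_true]
        subst h0
        exact ⟨P.t_mem 0, P.u_mem 0⟩
      · intro x hx
        simp [cons]
      · intro P hP
        have h0 := (Finset.mem_filter.mp hP).2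
        exact ext_of_tail h0.symm rfl rfl rfl rfl
      · rintro ⟨M, t, b, u, P⟩ hx
        simp only [Finset.mem_sigma, Finset.mem_filter] at hx
        obtain ⟨-, -, -, -, -, rfl⟩ := hx
        rfl
      · intro P hP
        rw [amp_succ]
    rw [e, Finset.sum_sigma, ← T.sum_odd f]
    refine Finset.sum_congr rfl fun M _ => ?_
    rw [Finset.sum_sigma]
    refine Finset.sum_congr rfl fun t _ => ?_
    rw [Finset.sum_sigma]
    have h1 : ∀ b : X.MN, ∑ x ∈ (T.even M b).sigma fun _ =>
        (Finset.univ : Finset (Path T k)).filter fun P => P.a 0 = b,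
        (t * x.1 * x.2.amp) * star (t * x.1 * x.2.amp)
        = t * (∑ u ∈ T.even M b, u * star u) * star t := by
      intro b
      rw [Finset.sum_sigma, Finset.mul_sum, Finset.sum_mul]
      refine Finset.sum_congr rfl fun u _ => ?_
      calc _ = ∑ P : Path T k with P.a 0 = b, t * u * (P.amp * star P.amp) * star (t * u) := by
            simp only [star_mul, mul_assoc]
        _ = _ := by
            rw [← Finset.sum_mul, ← Finset.mul_sum, ih b, mul_one, star_mul]
            simp only [mul_assoc]
    calc _ = ∑ b, t * (∑ u ∈ T.even M b, u * star u) * star t :=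
          Finset.sum_congr rfl fun b _ => h1 b
      _ = t * star t := by rw [← Finset.sum_mul, ← Finset.mul_sum, T.sum_even, mul_one]

open Classical in
/-- Expansion of an intertwiner in the orthonormal basis given by the paths between its
end points. -/
theorem sum_amp_mul_star_mul {f g : X.MN} {Y : ℳ}
    (hY : Y ∈ Hom ((X.mn f).comp (X.thetaPow k)) (X.mn g)) :
    ∑ P : Path T k with P.a 0 = f ∧ P.a (Fin.last k) = g, P.amp * (star P.amp * Y) = Y := by
  calc _ = ∑ P : Path T k with P.a 0 = f, P.amp * (star P.amp * Y) := by
        rw [← Finset.filter_filter, Finset.sum_filter]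
        refine Finset.sum_congr rfl fun P hP => ?_
        have h0 := (Finset.mem_filter.mp hP).2
        split_ifs with h
        · rfl
        · have hm := P.amp_mem
          rw [h0] at hm
          rw [eq_zero_of_not_equivalent (X.mn_irred _) (X.mn_irred _)
            (fun e => h (X.mn_inequiv _ _ e)) (Hom.mul_mem (Hom.star_mem hm) hY), mul_zero]
    _ = _ := by
        simp only [← mul_assoc]
        rw [← Finset.sum_mul, sum_amp_mul_star, one_mul]

end Path

/-! ### Contraction of the bonds -/

section Contract

/-- Contraction over an orthonormal basis of a bond space. -/
theorem sum_scalar_mul_scalar {A A' B : Type*} [Ring A] [StarRing A] [Algebra ℂ A]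
    [Ring A'] [StarRing A'] [Algebra ℂ A'] [Ring B] [StarRing B] [Algebra ℂ B] [Nontrivial B]
    {ρ μ : A →⋆ₐ[ℂ] B} {ν : A' →⋆ₐ[ℂ] B} (hμ : IsIrred μ) (hν : IsIrred ν) {S : Finset B}
    (hS : IsONB ρ μ S) {x l y : B} (hx : x ∈ Hom μ ρ)
    (hly : ∀ s ∈ S, l * star s * y ∈ Hom ν ν) :
    ∑ s ∈ S, scalar (x * s) * scalar (l * star s * y) = scalar (l * x * y) := by
  have e : l * x * y = ∑ s ∈ S, scalar (x * s) • (l * star s * y) := by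
    conv_lhs => rw [← hS.mul_sum_mul_star hx, Finset.mul_sum, Finset.mul_sum, Finset.sum_mul]
    refine Finset.sum_congr rfl fun s hs => ?_
    rw [← mul_assoc x, hμ.eq_scalar (Hom.mul_mem hx (hS.mem hs)), scalar_smul_one, smul_mul_assoc,
      one_mul, mul_smul_comm, smul_mul_assoc]
  rw [e, hν.scalar_sum S fun s hs => Submodule.smul_mem _ _ (hly s hs)]
  exact Finset.sum_congr rfl fun s hs => (hν.scalar_smul (hly s hs) _).symm

theorem sum_piFinset_cons {n : ℕ} {β : Type*} {R : Type*} [AddCommMonoid R]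
    (S : Fin (n + 1) → Finset β) (F : (Fin (n + 1) → β) → R) :
    ∑ p ∈ Fintype.piFinset S, F p
      = ∑ x ∈ S 0, ∑ p ∈ Fintype.piFinset (fun i : Fin n => S i.succ), F (Fin.cons x p) := by
  rw [← Finset.sum_product']
  refine Finset.sum_bij' (fun p _ => (p 0, Fin.tail p)) (fun x _ => Fin.cons x.1 x.2) ?_ ?_ ?_ ?_ ?_
  · intro p hp
    rw [Fintype.mem_piFinset] at hp
    simp only [Finset.mem_product, Fintype.mem_piFinset]
    exact ⟨hp 0, fun i => hp i.succ⟩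
  · intro x hx
    simp only [Finset.mem_product, Fintype.mem_piFinset] at hx
    rw [Fintype.mem_piFinset]
    exact fun i => Fin.cases hx.1 (fun i => hx.2 i) i
  · intro p _
    exact Fin.cons_self_tail p
  · intro x _
    simp
  · intro p _
    rw [Fin.cons_self_tail]

variable [Nontrivial ℳ] {T : BasisChoice X}

/-- Contraction of all bonds of the chain. Each basis intertwiner `s` of a bond occurs as `s` to its
left and as `s*` to its right, and `∑ s s*` acts as the identity on what stands to the left. -/
theorem sum_chain (B : X.MM) (m : ℕ) (P Q : Path T (m + 1)) (w v : ℳ)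
    (hw : w ∈ Hom (X.mn (Q.a 0)) ((X.mm B).comp (X.mn (P.a 0))))
    (hv : v ∈ Hom ((X.mm B).comp (X.mn (P.a (Fin.last (m + 1))))) (X.mn (Q.a (Fin.last (m + 1))))) :
    ∑ p ∈ Fintype.piFinset (fun i : Fin (m + 1) => T.fuseMM B (P.M i) (Q.M i)),
    ∑ q ∈ Fintype.piFinset (fun i : Fin m =>
        T.fuseMN B (P.a i.castSucc.succ) (Q.a i.castSucc.succ)),
      scalar (star (Q.t 0) * w * X.mm B (P.t 0) * p 0) *
      (∏ i : Fin m,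
        symbolUbar B (P.u i.castSucc) (p i.castSucc) (q i) (Q.u i.castSucc) *
        symbolU B (P.t i.succ) (q i) (p i.succ) (Q.t i.succ)) *
      scalar (star (Q.u (Fin.last m)) * star (p (Fin.last m)) *
        (X.mm B (P.u (Fin.last m)) * v))
    = scalar (star Q.amp * w * X.mm B P.amp * v) := by
  have hx : star (Q.t 0) * w * X.mm B (P.t 0)
      ∈ Hom (X.mm (Q.M 0)) ((X.mm B).comp (X.mm (P.M 0))) :=
    Hom.mul_mem (Hom.mul_mem (Hom.star_mem (Q.t_hom 0)) (Hom.whisker hw X.iotaBar))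
      (Hom.map_mem (P.t_hom 0) (X.mm B))
  induction m generalizing w with
  | zero =>
    rw [sum_piFinset_cons]
    simp only [Finset.univ_eq_empty, Finset.prod_empty, mul_one, Fintype.piFinset_of_isEmpty,
      Finset.univ_unique, Finset.sum_const, Finset.card_singleton, one_smul, Fin.cons_zero,
      Fin.last_zero, Fin.isValue]
    rw [sum_scalar_mul_scalar (X.mm_irred (Q.M 0)) (X.mn_irred (Q.a (Fin.last 1)))
      (T.fuseMM_onb B (P.M 0) (Q.M 0)) hx]
    · rw [Path.amp_succ, Path.amp_succ, Path.amp_zero, Path.amp_zero]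
      simp only [mul_one, star_mul, map_mul, mul_assoc]
    · intro s hs
      have hs' := Hom.whisker (Hom.star_mem ((T.fuseMM_onb B (P.M 0) (Q.M 0)).mem hs)) ι
      exact Hom.mul_mem (Hom.mul_mem (Hom.star_mem (Q.u_hom 0)) hs')
        (Hom.mul_mem (Hom.map_mem (P.u_hom 0) (X.mm B)) hv)
  | succ m ih =>
    set w' := star (Q.t 0 * Q.u 0) * w * X.mm B (P.t 0 * P.u 0) with hw'
    have hw1 : w' ∈ Hom (X.mn (Q.tail.a 0)) ((X.mm B).comp (X.mn (P.tail.a 0))) :=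
      Hom.mul_mem (Hom.mul_mem (Hom.star_mem Q.step_hom) (Hom.whisker hw (X.iotaBar.comp ι)))
        (Hom.map_mem P.step_hom (X.mm B))
    have hx1 : star (Q.tail.t 0) * w' * X.mm B (P.tail.t 0)
        ∈ Hom (X.mm (Q.tail.M 0)) ((X.mm B).comp (X.mm (P.tail.M 0))) :=
      Hom.mul_mem (Hom.mul_mem (Hom.star_mem (Q.tail.t_hom 0)) (Hom.whisker hw1 X.iotaBar))
        (Hom.map_mem (P.tail.t_hom 0) (X.mm B))
    have key : ∀ p₁ ∈ T.fuseMM B (P.M 1) (Q.M 1),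
        ∑ q ∈ T.fuseMN B (P.tail.a 0) (Q.tail.a 0), ∑ p ∈ T.fuseMM B (P.M 0) (Q.M 0),
          scalar (star (Q.t 0) * w * X.mm B (P.t 0) * p) *
            (symbolUbar B (P.u 0) p q (Q.u 0) * symbolU B (P.t 1) q p₁ (Q.t 1))
        = scalar (star (Q.tail.t 0) * w' * X.mm B (P.tail.t 0) * p₁) := by
      intro p₁ hp₁
      have hp₁' := (T.fuseMM_onb B (P.M 1) (Q.M 1)).mem hp₁
      have h1 : ∀ q ∈ T.fuseMN B (P.tail.a 0) (Q.tail.a 0),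
          ∑ p ∈ T.fuseMM B (P.M 0) (Q.M 0), scalar (star (Q.t 0) * w * X.mm B (P.t 0) * p) *
            (symbolUbar B (P.u 0) p q (Q.u 0) * symbolU B (P.t 1) q p₁ (Q.t 1))
          = scalar (w' * q) *
            scalar (star (Q.tail.t 0) * star q * (X.mm B (P.tail.t 0) * p₁)) := by
        intro q hq
        have hq' := (T.fuseMN_onb B (P.tail.a 0) (Q.tail.a 0)).mem hq
        have h2 := sum_scalar_mul_scalar (X.mm_irred (Q.M 0)) (X.mn_irred (Q.tail.a 0))
          (T.fuseMM_onb B (P.M 0) (Q.M 0)) hx (l := star (Q.u 0)) (y := X.mm B (P.u 0) * q)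
          (fun s hs => Hom.mul_mem (Hom.mul_mem (Hom.star_mem (Q.u_hom 0))
            (Hom.whisker (Hom.star_mem ((T.fuseMM_onb B (P.M 0) (Q.M 0)).mem hs)) ι))
            (Hom.mul_mem (Hom.map_mem (P.u_hom 0) (X.mm B)) hq'))
        have e1 : w' * q = star (Q.u 0) * (star (Q.t 0) * w * X.mm B (P.t 0)) *
            (X.mm B (P.u 0) * q) := by
          rw [hw', star_mul, map_mul]; simp only [mul_assoc]
        rw [e1, ← h2, Finset.sum_mul]
        refine Finset.sum_congr rfl fun p _ => ?_
        rw [symbolUbar, symbolU, star_mul, star_mul, ← mul_assoc]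
        simp only [mul_assoc]
        rfl
      rw [Finset.sum_congr rfl h1,
        sum_scalar_mul_scalar (X.mn_irred (Q.tail.a 0)) (X.mm_irred (Q.tail.M 0))
          (T.fuseMN_onb B (P.tail.a 0) (Q.tail.a 0)) hw1]
      · simp only [mul_assoc]
      · intro q hq
        exact Hom.mul_mem (Hom.mul_mem (Hom.star_mem (Q.tail.t_hom 0))
          (Hom.whisker (Hom.star_mem ((T.fuseMN_onb B (P.tail.a 0) (Q.tail.a 0)).mem hq))
            X.iotaBar)) (Hom.mul_mem (Hom.map_mem (P.tail.t_hom 0) (X.mm B)) hp₁')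
    have hih := ih P.tail Q.tail w' hw1 hv hx1
    rw [Path.amp_succ P, Path.amp_succ Q]
    have e2 : star (Q.t 0 * Q.u 0 * Q.tail.amp) * w * X.mm B (P.t 0 * P.u 0 * P.tail.amp) * v
        = star Q.tail.amp * w' * X.mm B P.tail.amp * v := by
      rw [hw', star_mul _ Q.tail.amp, map_mul _ _ P.tail.amp]; simp only [mul_assoc]
    rw [e2, ← hih, sum_piFinset_cons]
    rw [Finset.sum_comm]
    refine Finset.sum_congr rfl fun p' hp' => ?_
    have hp₁ : p' 0 ∈ T.fuseMM B (P.M 1) (Q.M 1) := Fintype.mem_piFinset.mp hp' 0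
    rw [← key _ hp₁]
    simp only [sum_piFinset_cons, Finset.sum_mul]
    rw [Finset.sum_comm]
    conv_rhs => rw [Finset.sum_comm]
    refine Finset.sum_congr rfl fun q _ => ?_
    rw [Finset.sum_comm]
    refine Finset.sum_congr rfl fun q' _ => Finset.sum_congr rfl fun p _ => ?_
    rw [Fin.prod_univ_succ]
    simp only [← mul_assoc]
    rfl

end Contract

end

variable {𝒩 ℳ : Type*} [Ring 𝒩] [StarRing 𝒩] [Algebra ℂ 𝒩]
  [Ring ℳ] [StarRing ℳ] [Algebra ℂ ℳ] {ι : 𝒩 →⋆ₐ[ℂ] ℳ} {X : EndoSystem ι}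

/-! ### The action on intertwiners -/

/-- The action `(1_c × r_d* × 1)(x × y)(1_a × r_b)` of `x ∈ Hom(c d̄, a b̄)` on
`y ∈ Hom(d τ, b)`, an element of `Hom(c τ, a)`. The formula is that of the vertical product. -/
def EndoSystem.act (X : EndoSystem ι) (c d a b : X.MN) (x y : ℳ) : ℳ :=
  X.mn c (star (X.r d)) * (x * X.mn a (X.mnBar b y)) * X.mn a (X.r b)

namespace EndoSystem

variable {c d a b f g : X.MN}

theorem act_mem {τ : 𝒩 →⋆ₐ[ℂ] 𝒩} {x y : ℳ} (hx : x ∈ Hom (X.abar c d) (X.abar a b))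
    (hy : y ∈ Hom ((X.mn d).comp τ) (X.mn b)) :
    X.act c d a b x y ∈ Hom ((X.mn c).comp τ) (X.mn a) := by
  have h1 := Hom.map_mem (X.mnConj b).r_mem (X.mn a)
  have h2 := Hom.map_mem hy ((X.mn a).comp (X.mnBar b))
  have h3 := Hom.whisker hx ((X.mn d).comp τ)
  have h4 := Hom.whisker (Hom.map_mem (Hom.star_mem (X.mnConj d).r_mem) (X.mn c)) τ
  exact Hom.mul_mem (Hom.mul_mem h4 (Hom.mul_mem h3 h2)) h1

theorem act_add_left (x x' y : ℳ) :
    X.act c d a b (x + x') y = X.act c d a b x y + X.act c d a b x' y := by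
  simp only [act, add_mul, mul_add]

theorem act_smul_left (z : ℂ) (x y : ℳ) :
    X.act c d a b (z • x) y = z • X.act c d a b x y := by
  simp only [act, smul_mul_assoc, mul_smul_comm]

theorem act_zero_left (y : ℳ) : X.act c d a b 0 y = 0 := by
  simp only [act, zero_mul, mul_zero]

theorem act_smul_right (z : ℂ) (x y : ℳ) :
    X.act c d a b x (z • y) = z • X.act c d a b x y := by
  simp only [act, map_smul, smul_mul_assoc, mul_smul_comm]

theorem act_sum_left {J : Type*} (S : Finset J) (F : J → ℳ) (y : ℳ) :
    X.act c d a b (∑ j ∈ S, F j) y = ∑ j ∈ S, X.act c d a b (F j) y := by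
  simp only [act, Finset.sum_mul, Finset.mul_sum]

theorem act_sum_right {J : Type*} (S : Finset J) (x : ℳ) (F : J → ℳ) :
    X.act c d a b x (∑ j ∈ S, F j) = ∑ j ∈ S, X.act c d a b x (F j) := by
  simp only [act, map_sum, Finset.sum_mul, Finset.mul_sum]

/-- The action is associative with the vertical product of homogeneous elements. -/
theorem act_act {x : ℳ} (hx : x ∈ Hom (X.abar c f) (X.abar a g)) (y z : ℳ) :
    X.act c f a g x (X.act f d g b y z)
      = X.act c d a b (X.mn c (star (X.r f)) * (x * X.mn a (X.mnBar g y)) * X.mn a (X.r g)) z := by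
  have h1 := hx (X.mn f (star (X.r d)))
  have h2 := (X.mnConj f).star_r_apply (star (X.r d))
  have h3 := (X.mnConj g).r_apply (X.mnBar b z * X.r b)
  simp only [StarAlgHom.comp_apply] at h1
  calc _ = X.mn c (star (X.r f)) * (x * X.mn a (X.mnBar g (X.mn f (star (X.r d)))))
          * X.mn a (X.mnBar g y)
          * X.mn a (X.mnBar g (X.mn g (X.mnBar b z * X.r b)) * X.r g) := by
        simp only [act, mul_assoc, map_mul]
    _ = X.mn c (star (X.r f) * X.mnBar f (X.mn f (star (X.r d)))) * x
          * X.mn a (X.mnBar g y) * X.mn a (X.r g * (X.mnBar b z * X.r b)) := by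
        rw [h1, h3]; simp only [mul_assoc, map_mul]
    _ = _ := by rw [h2]; simp only [act, mul_assoc, map_mul]

theorem act_mul (x y : DTA X) (z : ℳ) :
    X.act c d a b ((x * y) c d a b) z
      = ∑ f, ∑ g, X.act c f a g (x c f a g) (X.act f d g b (y f d g b) z) := by
  rw [DTA.mul_apply, act_sum_left]
  refine Finset.sum_congr rfl fun f _ => ?_
  rw [act_sum_left]
  exact Finset.sum_congr rfl fun g _ => (act_act (x c f a g).2 _ _).symm

open Classical in
theorem act_one (z : ℳ) :
    X.act c d a b ((1 : DTA X) c d a b) z = if c = d ∧ a = b then z else 0 := by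
  rw [DTA.one_apply]
  split_ifs with h
  · obtain ⟨rfl, rfl⟩ := h
    calc _ = (X.mn c (star (X.r c)) * (X.mnConj c).rbar)
          * (star (X.mnConj a).rbar * X.mn a (X.mnBar a z)) * X.mn a (X.r a) := by
          simp only [act, mul_assoc]
      _ = z := by
          rw [(X.mnConj a).star_rbar_apply, (X.mnConj c).conj_left, one_mul, mul_assoc,
            (X.mnConj a).conj_left_star, mul_one]
  · exact act_zero_left z

end EndoSystem

/-! ### The representation -/

section Rep

variable {T : BasisChoice X} {m : ℕ}

/-- The factor `(d_M / d_b)^{1/2}` at the last site of a path, the normalization of the Frobenius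
dual of its last intertwiner. -/
def Path.gauge (P : Path T (m + 1)) : ℂ :=
  (((X.dMN (P.a (Fin.last (m + 1))) / X.dMM (P.M (Fin.last m))) ^ (-(1 / 2) : ℝ) : ℝ) : ℂ)

/-- The matrix coefficient of the action of `x` between the intertwiners of two paths. -/
def coeff (x : DTA X) (Q P : Path T (m + 1)) : ℂ :=
  scalar (star Q.amp * X.act (Q.a 0) (P.a 0) (Q.a (Fin.last (m + 1))) (P.a (Fin.last (m + 1)))
    (x (Q.a 0) (P.a 0) (Q.a (Fin.last (m + 1))) (P.a (Fin.last (m + 1)))) P.amp)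

theorem coeff_mem {x : ℳ} {Q P : Path T (m + 1)}
    (hx : x ∈ Hom (X.abar (Q.a 0) (P.a 0))
      (X.abar (Q.a (Fin.last (m + 1))) (P.a (Fin.last (m + 1))))) :
    star Q.amp * X.act (Q.a 0) (P.a 0) (Q.a (Fin.last (m + 1))) (P.a (Fin.last (m + 1))) x P.amp
      ∈ Hom (X.mn (Q.a (Fin.last (m + 1)))) (X.mn (Q.a (Fin.last (m + 1)))) :=
  Hom.mul_mem (Hom.star_mem Q.amp_mem) (EndoSystem.act_mem hx P.amp_mem)

variable [Nontrivial ℳ]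

theorem coeff_add (x y : DTA X) (Q P : Path T (m + 1)) :
    coeff (x + y) Q P = coeff x Q P + coeff y Q P := by
  rw [coeff, DTA.add_apply, EndoSystem.act_add_left, mul_add,
    (X.mn_irred _).scalar_add (coeff_mem (x _ _ _ _).2) (coeff_mem (y _ _ _ _).2)]
  rfl

theorem coeff_smul (z : ℂ) (x : DTA X) (Q P : Path T (m + 1)) :
    coeff (z • x) Q P = z * coeff x Q P := by
  rw [coeff, DTA.smul_apply, EndoSystem.act_smul_left, mul_smul_comm,
    (X.mn_irred _).scalar_smul (coeff_mem (x _ _ _ _).2)]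
  rfl

theorem dMN_pos [Nontrivial 𝒩] [ProperStar 𝒩] (a : X.MN) : 0 < X.dMN a := (X.mnConj a).d_pos

theorem dMM_pos [ProperStar ℳ] (B : X.MM) : 0 < X.dMM B := (X.mmConj B).d_pos

theorem Path.gauge_ne_zero [Nontrivial 𝒩] [ProperStar 𝒩] [ProperStar ℳ] (P : Path T (m + 1)) :
    P.gauge ≠ 0 := by
  rw [Path.gauge, Complex.ofReal_ne_zero]
  exact (Real.rpow_pos_of_pos (div_pos (dMN_pos _) (dMM_pos _)) _).ne'

variable [StarModule ℂ ℳ]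

/-- The conjugate of the left boundary symbol starts the contraction of the bonds, with
`(1_c × r_d* × 1) s` in `Hom(c, B d)` acting from the left. -/
theorem conj_symbolZ {B : X.MM} {c d : X.MN} {M M' : X.MM} {s t t' p : ℳ}
    (hs : s ∈ Hom (X.abar c d) (X.mm B)) (ht : t ∈ Hom ((X.mn d).comp X.iotaBar) (X.mm M))
    (ht' : t' ∈ Hom ((X.mn c).comp X.iotaBar) (X.mm M'))
    (hp : p ∈ Hom ((X.mm B).comp (X.mm M)) (X.mm M')) :
    (starRingEnd ℂ) (symbolZ c d s t p t')
      = scalar (star t' * (X.mn c (star (X.r d)) * s) * X.mm B t * p) := by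
  have hw : X.mn c (star (X.r d)) * s ∈ Hom (X.mn c) ((X.mm B).comp (X.mn d)) :=
    Hom.mul_mem (Hom.map_mem (Hom.star_mem (X.mnConj d).r_mem) (X.mn c))
      (Hom.whisker hs (X.mn d))
  have hmem : star t' * (X.mn c (star (X.r d)) * s) * X.mm B t * p ∈ Hom (X.mm M') (X.mm M') :=
    Hom.mul_mem (Hom.mul_mem (Hom.mul_mem (Hom.star_mem ht') (Hom.whisker hw X.iotaBar))
      (Hom.map_mem ht (X.mm B))) hp
  have h1 := Hom.star_mem hs (star t)
  rw [symbolZ, dhr, h1]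
  rw [← Complex.conj_conj (scalar (star t' * (X.mn c (star (X.r d)) * s) * X.mm B t * p)),
    ← (X.mm_irred M').scalar_star hmem]
  simp only [star_mul, star_star, ← map_star, mul_assoc]

variable [ProperStar ℳ]

theorem coeff_mul (x y : DTA X) (Q P : Path T (m + 1)) :
    coeff (x * y) Q P = ∑ R : Path T (m + 1), coeff x Q R * coeff y R P := by
  classical
  set c := Q.a 0
  set a := Q.a (Fin.last (m + 1))
  set d := P.a 0
  set b := P.a (Fin.last (m + 1))
  -- the summand for intermediate end points `f`, `g` is expanded over the paths from `f` to `g`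
  have key : ∀ f g : X.MN,
      star Q.amp * X.act c f a g (x c f a g) (X.act f d g b (y f d g b) P.amp)
      = ∑ R : Path T (m + 1) with R.a 0 = f ∧ R.a (Fin.last (m + 1)) = g,
          (coeff x Q R * coeff y R P) • (1 : ℳ) := by
    intro f g
    have hY := EndoSystem.act_mem (y f d g b).2 P.amp_mem
    conv_lhs => rw [← Path.sum_amp_mul_star_mul (T := T) hY, EndoSystem.act_sum_right, Finset.mul_sum]
    refine Finset.sum_congr rfl fun R hR => ?_
    obtain ⟨rfl, rfl⟩ := (Finset.mem_filter.mp hR).2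
    have h1 := (X.mn_irred _).eq_scalar (coeff_mem (Q := R) (P := P) (y _ _ _ _).2)
    have h2 := (X.mn_irred _).eq_scalar (coeff_mem (Q := Q) (P := R) (x _ _ _ _).2)
    rw [h1, mul_smul_comm, mul_one, EndoSystem.act_smul_right, mul_smul_comm, h2, smul_smul,
      mul_comm]
    rfl
  have e : star Q.amp * X.act c d a b ((x * y) c d a b) P.amp
      = (∑ R : Path T (m + 1), coeff x Q R * coeff y R P) • (1 : ℳ) := by
    rw [EndoSystem.act_mul]
    simp only [Finset.mul_sum, key, Finset.sum_smul]
    rw [← Finset.sum_fiberwise (s := (Finset.univ : Finset (Path T (m + 1))))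
      (g := fun R => R.a 0)]
    refine Finset.sum_congr rfl fun f _ => ?_
    rw [← Finset.sum_fiberwise (s := (Finset.univ : Finset (Path T (m + 1))).filter
      fun R => R.a 0 = f) (g := fun R => R.a (Fin.last (m + 1)))]
    simp only [Finset.filter_filter]
  rw [coeff, e, scalar_smul_one]

open Classical in
theorem coeff_one (Q P : Path T (m + 1)) : coeff (1 : DTA X) Q P = if Q = P then 1 else 0 := by
  rw [coeff, EndoSystem.act_one]
  split_ifs with h hQP hQP
  · rw [hQP, Path.star_amp_mul_amp_self, scalar_one]
  · rw [Path.star_amp_mul_amp_of_ne h.1 hQP, scalar_zero]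
  · exact absurd ⟨by rw [hQP], by rw [hQP]⟩ h
  · rw [mul_zero, scalar_zero]

variable [Nontrivial 𝒩] [ProperStar 𝒩]

/-- The representation of the double triangle algebra on the open chain: the action on the
intertwiners of paths, conjugated by the gauge factors. -/
def rep (T : BasisChoice X) (m : ℕ) : DTA X →ₐ[ℂ] Module.End ℂ (OpenChain T (m + 1)) := by
  classical
  exact AlgHom.comp (Matrix.toLinAlgEquiv' (R := ℂ) (n := Path T (m + 1))).toAlgHom
    (AlgHom.ofLinearMap
      { toFun := fun x => Matrix.of fun Q P => P.gauge / Q.gauge * coeff x Q P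
        map_add' := fun x y => by
          ext Q P
          simp only [Matrix.of_apply, Matrix.add_apply, coeff_add, mul_add]
        map_smul' := fun z x => by
          ext Q P
          simp only [Matrix.of_apply, Matrix.smul_apply, coeff_smul, RingHom.id_apply, smul_eq_mul]
          ring }
      (by
        ext Q P
        simp only [LinearMap.coe_mk, AddHom.coe_mk, Matrix.of_apply, coeff_one, Matrix.one_apply]
        split_ifs with h
        · rw [h, div_self P.gauge_ne_zero, mul_one]
        · rw [mul_zero])
      (fun x y => by
        ext Q P
        simp only [LinearMap.coe_mk, AddHom.coe_mk, Matrix.of_apply, coeff_mul, Matrix.mul_apply,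
          Finset.mul_sum]
        refine Finset.sum_congr rfl fun R _ => ?_
        have := R.gauge_ne_zero
        field_simp))

open Classical in
theorem rep_apply (x : DTA X) :
    rep T m x = Matrix.toLin' (Matrix.of fun Q P => P.gauge / Q.gauge * coeff x Q P) := by
  ext
  rfl

/-! ### The boundary symbols -/

variable [StarModule ℂ 𝒩]

/-- The boundary symbol of the Frobenius duals. The right-hand side is the contraction of the
bonds continued over the last site, up to the gauge factors. -/
theorem symbolZ_frobenius {B : X.MM} {a b : X.MN} {M M' : X.MM} {t u u' p : ℳ}
    (ht : t ∈ Hom (X.abar a b) (X.mm B)) (hu : u ∈ Hom ((X.mm M).comp ι) (X.mn b))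
    (hu' : u' ∈ Hom ((X.mm M').comp ι) (X.mn a))
    (hp : p ∈ Hom ((X.mm B).comp (X.mm M)) (X.mm M')) :
    symbolZ a b t (frobenius M b u) p (frobenius M' a u')
      = (((X.dMN b / X.dMM M) ^ (-(1 / 2) : ℝ) : ℝ) : ℂ)
        / (((X.dMN a / X.dMM M') ^ (-(1 / 2) : ℝ) : ℝ) : ℂ)
        * scalar (star u' * star p * (X.mm B u * (star t * X.mn a (X.r b)))) := by
  set γ : ℝ := (X.dMN b / X.dMM M) ^ (-(1 / 2) : ℝ)
  set γ' : ℝ := (X.dMN a / X.dMM M') ^ (-(1 / 2) : ℝ) with hγ'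
  set y : ℳ := star p * (X.mm B u * (star t * X.mn a (X.r b))) with hy
  have hv : star t * X.mn a (X.r b) ∈ Hom ((X.mm B).comp (X.mn b)) (X.mn a) :=
    Hom.mul_mem (Hom.whisker (Hom.star_mem ht) (X.mn b)) (Hom.map_mem (X.mnConj b).r_mem (X.mn a))
  have hym : y ∈ Hom ((X.mm M').comp ι) (X.mn a) :=
    Hom.mul_mem (Hom.whisker (Hom.star_mem hp) ι) (Hom.mul_mem (Hom.map_mem hu (X.mm B)) hv)
  have hstar : star (frobenius M b u) = (γ : ℂ) • (X.mm M (star X.iotaConj.rbar) * u) := by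
    rw [frobenius, star_smul, star_mul, star_star, ← map_star]
    congr 1
    exact Complex.conj_ofReal γ
  have h1 := Hom.star_mem ht (X.mm M (star X.iotaConj.rbar) * u)
  have h2 := Hom.star_mem hp (star X.iotaConj.rbar)
  rw [StarAlgHom.comp_apply] at h1 h2
  have e : star p * dhr (X.abar a b) (star t) (star (frobenius M b u)) * X.mn a (X.r b)
        * frobenius M' a u'
      = ((γ : ℂ) * γ') • (X.mm M' (star X.iotaConj.rbar) * (y * star u')
        * X.mm M' X.iotaConj.rbar) := by
    calc _ = ((γ : ℂ) * γ') • (star p * (star t * X.mn a (X.mnBar b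
            (X.mm M (star X.iotaConj.rbar) * u))) * X.mn a (X.r b)
            * (star u' * X.mm M' X.iotaConj.rbar)) := by
          rw [dhr, hstar, frobenius, StarAlgHom.comp_apply, map_smul, map_smul,
            mul_smul_comm (γ : ℂ), mul_smul_comm (γ : ℂ), smul_mul_assoc (γ : ℂ),
            smul_mul_smul_comm]
      _ = ((γ : ℂ) * γ') • (star p * X.mm B (X.mm M (star X.iotaConj.rbar)) * X.mm B u
            * (star t * X.mn a (X.r b)) * (star u' * X.mm M' X.iotaConj.rbar)) := by
          rw [h1, map_mul]; simp only [mul_assoc]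
      _ = _ := by rw [h2, hy]; simp only [mul_assoc]
  rw [symbolZ, e, partial_trace_mul_star X.iotaConj (X.mmConj M') (X.mnConj a) X.iota_irred
    (X.mm_irred M') (X.mn_irred a) hym hu', smul_smul, scalar_smul_one]
  have hd : 0 < X.dMN a / X.dMM M' := div_pos (dMN_pos _) (dMM_pos _)
  have hγ0 : (γ' : ℂ) ≠ 0 := Complex.ofReal_ne_zero.mpr (Real.rpow_pos_of_pos hd _).ne'
  have hγ2 : (γ' : ℂ) * γ' * (X.dMN a / X.dMM M') = 1 := by
    rw [← Complex.ofReal_div, ← Complex.ofReal_mul, ← Complex.ofReal_mul, hγ',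
      ← Real.rpow_add hd, show (-(1 / 2) : ℝ) + -(1 / 2) = -1 by norm_num, Real.rpow_neg_one,
      inv_mul_cancel₀ hd.ne', Complex.ofReal_one]
  rw [hy, ← mul_assoc (star u'), mul_comm (scalar _), ← mul_assoc]
  congr 1
  rw [eq_div_iff hγ0, mul_assoc, mul_assoc]
  rw [show (γ' : ℂ) * (((X.mnConj a).d : ℂ) / ((X.mmConj M').d : ℂ) * γ')
    = (γ' : ℂ) * γ' * (X.dMN a / X.dMM M') by ring, hγ2, mul_one]

/-! ### Matrix product operators -/

/-- The matrix elements of the matrix product operators are those of the conjugated action. -/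
theorem matrixE_eq {B : X.MM} {a b a' b' : X.MN} {s t : ℳ}
    (hs : s ∈ Hom (X.abar a' b') (X.mm B)) (ht : t ∈ Hom (X.abar a b) (X.mm B))
    (P Q : Path T (m + 1)) :
    matrixE T m B a' b' a b s t P Q = P.gauge / Q.gauge * coeff (DTA.e hs ht) Q P := by
  classical
  rw [matrixE]
  split_ifs with h
  · obtain ⟨rfl, rfl, rfl, rfl⟩ := h
    have hw : X.mn (Q.a 0) (star (X.r (P.a 0))) * s
        ∈ Hom (X.mn (Q.a 0)) ((X.mm B).comp (X.mn (P.a 0))) :=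
      Hom.mul_mem (Hom.map_mem (Hom.star_mem (X.mnConj _).r_mem) (X.mn (Q.a 0)))
        (Hom.whisker hs (X.mn (P.a 0)))
    have hv : star t * X.mn (Q.a (Fin.last (m + 1))) (X.r (P.a (Fin.last (m + 1))))
        ∈ Hom ((X.mm B).comp (X.mn (P.a (Fin.last (m + 1))))) (X.mn (Q.a (Fin.last (m + 1)))) :=
      Hom.mul_mem (Hom.whisker (Hom.star_mem ht) (X.mn _)) (Hom.map_mem (X.mnConj _).r_mem (X.mn _))
    have hsum := sum_chain B m P Q _ _ hw hv
    have h1 := Hom.star_mem ht P.amp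
    rw [StarAlgHom.comp_apply] at h1
    have hc : coeff (DTA.e hs ht) Q P
        = (((X.dMN (Q.a (Fin.last (m + 1))) * X.dMN (P.a (Fin.last (m + 1))) * X.dMN (Q.a 0)
            * X.dMN (P.a 0)) ^ (1 / 4 : ℝ) : ℝ) : ℂ) *
          scalar (star Q.amp * (X.mn (Q.a 0) (star (X.r (P.a 0))) * s) * X.mm B P.amp *
            (star t * X.mn (Q.a (Fin.last (m + 1))) (X.r (P.a (Fin.last (m + 1)))))) := by
      have hst : s * star t ∈ Hom (X.abar (Q.a 0) (P.a 0))
          (X.abar (Q.a (Fin.last (m + 1))) (P.a (Fin.last (m + 1)))) :=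
        Hom.mul_mem hs (Hom.star_mem ht)
      have hm := coeff_mem (Q := Q) (P := P) hst
      simp only [coeff, DTA.e, and_self, if_true]
      rw [EndoSystem.act_smul_left, mul_smul_comm, (X.mn_irred _).scalar_smul hm]
      congr 2
      rw [EndoSystem.act, mul_assoc s, h1]
      simp only [mul_assoc]
    rw [hc, ← hsum]
    simp only [Finset.mul_sum]
    refine Finset.sum_congr rfl fun p hp => Finset.sum_congr rfl fun q _ => ?_
    rw [Fintype.mem_piFinset] at hp
    rw [conj_symbolZ hs (P.t_hom 0) (Q.t_hom 0) ((T.fuseMM_onb _ _ _).mem (hp 0)),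
      symbolZ_frobenius ht (P.u_hom (Fin.last m)) (Q.u_hom (Fin.last m))
        ((T.fuseMM_onb _ _ _).mem (hp (Fin.last m))), Path.gauge, Path.gauge]
    ring
  · have h0 : coeff (DTA.e hs ht) Q P = 0 := by
      have h' : ¬ (Q.a 0 = a' ∧ P.a 0 = b' ∧ Q.a (Fin.last (m + 1)) = a ∧
          P.a (Fin.last (m + 1)) = b) := fun ⟨h1, h2, h3, h4⟩ => h ⟨h2, h4, h1, h3⟩
      simp only [coeff, DTA.e, if_neg h']
      rw [EndoSystem.act_zero_left, mul_zero, scalar_zero]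
    rw [h0, mul_zero]

theorem rep_e {B : X.MM} {a b a' b' : X.MN} {s t : ℳ}
    (hs : s ∈ Hom (X.abar a' b') (X.mm B)) (ht : t ∈ Hom (X.abar a b) (X.mm B)) :
    rep T m (DTA.e hs ht) = mpo T m B a' b' a b s t := by
  rw [rep_apply, mpo]
  congr 2
  funext Q P
  exact (matrixE_eq hs ht P Q).symm

end Rep

/-! ### The matrix units span the double triangle algebra -/

/-- Evaluation of a component, as a linear map. -/
def DTA.component (c d a b : X.MN) : DTA X →ₗ[ℂ] ℳ where
  toFun x := x c d a b
  map_add' _ _ := rfl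
  map_smul' _ _ := rfl

open Classical in
theorem DTA.component_e {c d a b c' d' a' b' : X.MN} {B : X.MM} {s t : ℳ}
    (hs : s ∈ Hom (X.abar c d) (X.mm B)) (ht : t ∈ Hom (X.abar a b) (X.mm B)) :
    DTA.component c' d' a' b' (DTA.e hs ht) = if c' = c ∧ d' = d ∧ a' = a ∧ b' = b then
      (((X.dMN a * X.dMN b * X.dMN c * X.dMN d) ^ (1 / 4 : ℝ) : ℝ) : ℂ) • (s * star t) else 0 :=
  rfl

section Span

variable [Nontrivial ℳ] [StarModule ℂ ℳ] [ProperStar ℳ] (T : BasisChoice X)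

/-- Expansion of an intertwiner between `a b̄` and `c d̄` through the `ℳ-ℳ` system. -/
theorem sum_scalar_smul_mul_star {c d a b : X.MN} {x : ℳ}
    (hx : x ∈ Hom (X.abar c d) (X.abar a b)) :
    ∑ B, ∑ s ∈ T.tri c d B, ∑ t ∈ T.tri a b B, scalar (star s * x * t) • (s * star t) = x := by
  have e : (∑ B, ∑ s ∈ T.tri c d B, s * star s) * x * (∑ B, ∑ t ∈ T.tri a b B, t * star t)
      = x := by rw [T.sum_tri, T.sum_tri, one_mul, mul_one]
  conv_rhs => rw [← e]
  rw [Finset.sum_mul, Finset.sum_mul]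
  refine Finset.sum_congr rfl fun B _ => ?_
  rw [Finset.sum_mul, Finset.sum_mul]
  refine Finset.sum_congr rfl fun s hs => ?_
  have hs' := (T.tri_onb c d B).mem hs
  rw [Finset.mul_sum, Finset.sum_eq_single B]
  · rw [Finset.mul_sum]
    refine Finset.sum_congr rfl fun t ht => ?_
    have h1 := (X.mm_irred B).eq_scalar
      (Hom.mul_mem (Hom.mul_mem (Hom.star_mem hs') hx) ((T.tri_onb a b B).mem ht))
    calc scalar (star s * x * t) • (s * star t)
        = s * (scalar (star s * x * t) • (1 : ℳ)) * star t := by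
          rw [mul_smul_comm, mul_one, smul_mul_assoc]
      _ = _ := by rw [← h1]; simp only [mul_assoc]
  · intro B' _ hB
    rw [Finset.mul_sum]
    refine Finset.sum_eq_zero fun t ht => ?_
    have h1 : star s * x * t = 0 :=
      eq_zero_of_not_equivalent (X.mm_irred B) (X.mm_irred B')
        (fun e => hB (X.mm_inequiv _ _ e).symm)
        (Hom.mul_mem (Hom.mul_mem (Hom.star_mem hs') hx) ((T.tri_onb a b B').mem ht))
    calc _ = s * (star s * x * t) * star t := by simp only [mul_assoc]
      _ = 0 := by rw [h1, mul_zero, zero_mul]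
  · simp

variable [Nontrivial 𝒩] [ProperStar 𝒩]

/-- The matrix units `e` span: the normalization is invertible since dimensions are positive. -/
theorem span_e_eq_top : Submodule.span ℂ {x : DTA X | ∃ (B : X.MM) (a b a' b' : X.MN) (s t : ℳ)
    (hs : s ∈ T.tri a' b' B) (ht : t ∈ T.tri a b B),
      x = DTA.e ((T.tri_onb a' b' B).mem hs) ((T.tri_onb a b B).mem ht)} = ⊤ := by
  classical
  rw [eq_top_iff]
  intro x _
  have hx : x = ∑ c, ∑ d, ∑ a, ∑ b, ∑ B, ∑ s : T.tri c d B, ∑ t : T.tri a b B,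
      (scalar (star s.1 * x c d a b * t.1) *
        (((X.dMN a * X.dMN b * X.dMN c * X.dMN d) ^ (1 / 4 : ℝ) : ℝ) : ℂ)⁻¹) •
      (DTA.e ((T.tri_onb c d B).mem s.2) ((T.tri_onb a b B).mem t.2) : DTA X) := by
    ext c d a b
    change _ = DTA.component c d a b _
    simp only [map_sum, map_smul]
    have hz : ∀ (c' d' a' b' : X.MN) (B : X.MM) (s : T.tri c' d' B) (t : T.tri a' b' B),
        ¬ (c = c' ∧ d = d' ∧ a = a' ∧ b = b') →
        DTA.component c d a b
          (DTA.e ((T.tri_onb c' d' B).mem s.2) ((T.tri_onb a' b' B).mem t.2)) = 0 := by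
      intro c' d' a' b' B s t h
      rw [DTA.component_e, if_neg h]
    rw [Finset.sum_eq_single c, Finset.sum_eq_single d, Finset.sum_eq_single a,
      Finset.sum_eq_single b]
    rotate_left
    · intro b' _ h
      refine Finset.sum_eq_zero fun B _ => Finset.sum_eq_zero fun s _ =>
        Finset.sum_eq_zero fun t _ => ?_
      rw [hz _ _ _ _ _ _ _ fun e => h e.2.2.2.symm, smul_zero]
    · simp
    · intro a' _ h
      refine Finset.sum_eq_zero fun b' _ => Finset.sum_eq_zero fun B _ =>
        Finset.sum_eq_zero fun s _ => Finset.sum_eq_zero fun t _ => ?_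
      rw [hz _ _ _ _ _ _ _ fun e => h e.2.2.1.symm, smul_zero]
    · simp
    · intro d' _ h
      refine Finset.sum_eq_zero fun a' _ => Finset.sum_eq_zero fun b' _ =>
        Finset.sum_eq_zero fun B _ =>
        Finset.sum_eq_zero fun s _ => Finset.sum_eq_zero fun t _ => ?_
      rw [hz _ _ _ _ _ _ _ fun e => h e.2.1.symm, smul_zero]
    · simp
    · intro c' _ h
      refine Finset.sum_eq_zero fun d' _ => Finset.sum_eq_zero fun a' _ =>
        Finset.sum_eq_zero fun b' _ => Finset.sum_eq_zero fun B _ =>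
        Finset.sum_eq_zero fun s _ => Finset.sum_eq_zero fun t _ => ?_
      rw [hz _ _ _ _ _ _ _ fun e => h e.1.symm, smul_zero]
    · simp
    have hD : (((X.dMN a * X.dMN b * X.dMN c * X.dMN d) ^ (1 / 4 : ℝ) : ℝ) : ℂ) ≠ 0 := by
      rw [Complex.ofReal_ne_zero]
      exact (Real.rpow_pos_of_pos (mul_pos (mul_pos (mul_pos (dMN_pos a) (dMN_pos b))
        (dMN_pos c)) (dMN_pos d)) _).ne'
    refine (sum_scalar_smul_mul_star T (x c d a b).2).symm.trans ?_
    refine Finset.sum_congr rfl fun B _ => ?_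
    rw [← Finset.sum_coe_sort]
    refine Finset.sum_congr rfl fun s _ => ?_
    rw [← Finset.sum_coe_sort]
    refine Finset.sum_congr rfl fun t _ => ?_
    rw [DTA.component_e, if_pos ⟨rfl, rfl, rfl, rfl⟩, smul_smul,
      inv_mul_cancel_right₀ hD]
  rw [hx]
  refine Submodule.sum_mem _ fun c _ => Submodule.sum_mem _ fun d _ => Submodule.sum_mem _ fun a _ =>
    Submodule.sum_mem _ fun b _ => Submodule.sum_mem _ fun B _ => Submodule.sum_mem _ fun s _ =>
    Submodule.sum_mem _ fun t _ => Submodule.smul_mem _ _ (Submodule.subset_span ?_)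
  exact ⟨B, a, b, c, d, s, t, s.2, t.2, rfl⟩

end Span

/-! ### Von Neumann algebras -/

theorem properStar_vonNeumannAlgebra {H : Type*} [NormedAddCommGroup H] [InnerProductSpace ℂ H]
    [CompleteSpace H] [Nontrivial H] (M : VonNeumannAlgebra H) : ProperStar M.toStarSubalgebra where
  nonneg_of_star_mul_self x c hx := by
    obtain ⟨v, hv⟩ := exists_ne (0 : H)
    have h1 : star (x : H →L[ℂ] H) * (x : H →L[ℂ] H) = c • (1 : H →L[ℂ] H) :=
      congrArg Subtype.val hx
    have h2 : (‖(x : H →L[ℂ] H) v‖ ^ 2 : ℂ) = c * (‖v‖ ^ 2 : ℂ) := by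
      have h3 := congrArg (fun y : H →L[ℂ] H => inner ℂ v (y v)) h1
      simp only [mul_apply_eq_comp, ContinuousLinearMap.star_eq_adjoint,
        ContinuousLinearMap.adjoint_inner_right, smul_apply,
        one_apply_eq_self, inner_smul_right] at h3
      simp only [inner_self_eq_norm_sq_to_K] at h3
      exact h3
    have hv' : (‖v‖ : ℂ) ≠ 0 := by simpa using hv
    refine ⟨‖(x : H →L[ℂ] H) v‖ ^ 2 / ‖v‖ ^ 2, by positivity, ?_⟩
    push_cast
    rw [h2]
    field_simp
  eq_zero_of_star_mul_self x hx := by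
    have h1 : star (x : H →L[ℂ] H) * (x : H →L[ℂ] H) = 0 := congrArg Subtype.val hx
    exact Subtype.ext ((CStarRing.star_mul_self_eq_zero_iff _).mp h1)

end

end DoubleTriangle

theorem mainTheorem3
    {H : Type*} [NormedAddCommGroup H] [InnerProductSpace ℂ H] [CompleteSpace H] [Nontrivial H]
    (N M : VonNeumannAlgebra H) (hNM : N.toStarSubalgebra ≤ M.toStarSubalgebra)
    (X : DoubleTriangle.EndoSystem (StarSubalgebra.inclusion hNM))
    (T : DoubleTriangle.BasisChoice X) (m : ℕ) :
    ∃ π : DoubleTriangle.DTA X →ₐ[ℂ] Module.End ℂ (DoubleTriangle.OpenChain T (m + 1)),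
      (∀ (B : X.MM) (a b a' b' : X.MN) (s t : M.toStarSubalgebra)
        (hs : s ∈ T.tri a' b' B) (ht : t ∈ T.tri a b B),
        π (DoubleTriangle.DTA.e ((T.tri_onb a' b' B).mem hs) ((T.tri_onb a b B).mem ht)) =
          DoubleTriangle.mpo T m B a' b' a b s t) ∧
      ∀ f : DoubleTriangle.DTA X →ₗ[ℂ] Module.End ℂ (DoubleTriangle.OpenChain T (m + 1)),
        (∀ (B : X.MM) (a b a' b' : X.MN) (s t : M.toStarSubalgebra)
          (hs : s ∈ T.tri a' b' B) (ht : t ∈ T.tri a b B),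
          f (DoubleTriangle.DTA.e ((T.tri_onb a' b' B).mem hs) ((T.tri_onb a b B).mem ht)) =
            DoubleTriangle.mpo T m B a' b' a b s t) →
        f = π.toLinearMap := by
  have := DoubleTriangle.properStar_vonNeumannAlgebra N
  have := DoubleTriangle.properStar_vonNeumannAlgebra M
  refine ⟨DoubleTriangle.rep T m, fun B a b a' b' s t hs ht => DoubleTriangle.rep_e _ _,
    fun f hf => ?_⟩
  refine LinearMap.ext_on (DoubleTriangle.span_e_eq_top T) ?_
  rintro _ ⟨B, a, b, a', b', s, t, hs, ht, rfl⟩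
  rw [hf B a b a' b' s t hs ht]
  exact (DoubleTriangle.rep_e _ _).symm
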